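/- Let $G$ be a connected (finite-dimensional, real) Lie group with Lie algebra $\mathfrak g$ (bracket of left-invariant vector fields), let $H\subset G$ be a closed subgroup with Lie algebra $\mathfrak h=\{u\in\mathfrak g : \exp(tu)\in H\ \forall t\in\mathbb R\}$, and let $G/H$ carry its standard smooth structure, for which the projection $p:G\to G/H$ is a smooth submersion; $G$ acts on $G/H$ by $\lambda_g(\bar x)=\overline{gx}$, and $\bar e=p(e)$. Suppose that $(G,H)$ is a reductive pair with a fixed decomposition $\mathfrak g=\mathfrak h\oplus\mathfrak m$, where $\mathfrak m$ is a linear subspace with $\mathrm{Ad}_a(\mathfrak m)=\mathfrak m$ for all $a\in H$. Write $u_{\mathfrak m}$ for the projection of $u\in\mathfrak g$ onto $\mathfrak m$ along $\mathfrak h$. Bivectors are regarded as skew-symmetric bilinear forms on the dual space. Let $(\wedge^2\mathfrak m)^H$ be the space of those $r\in\wedge^2\mathfrak m$ with $r(\alpha\circ\mathrm{Ad}_a|_{\mathfrak m},\beta\circ\mathrm{Ad}_a|_{\mathfrak m})=r(\alpha,\beta)$ for all $a\in H$, $\alpha,\beta\in\mathfrak m^*$; let $\mathfrak m^H=\{u\in\mathfrak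 m:\mathrm{Ad}_a u=u\ \forall a\in H\}$ and $(\mathfrak m^*)^H=\{\alpha\in\mathfrak m^*:\alpha\circ\mathrm{Ad}_a|_{\mathfrak m}=\alpha\ \forall a\in H\}$. For $r\in\wedge^2\mathfrak m$ define $r_\#:\mathfrak m^*\to\mathfrak m$, $\alpha\mapsto\alpha^\#$, by $\langle\beta,\alpha^\#\rangle=r(\alpha,\beta)$, and put $$[\alpha,\beta]_r=\bigl(-\mathrm{ad}^*_{\alpha^\#}\widetilde\beta+\mathrm{ad}^*_{\beta^\#}\widetilde\alpha\bigr)\big|_{\mathfrak m},\qquad \alpha,\beta\in\mathfrak m^*,$$ where $\widetilde\alpha\in\mathfrak g^*$ is the extension of $\alpha$ that vanishes on $\mathfrak h$, and $\langle\mathrm{ad}_u^*\eta,v\rangle=\langle\eta,[u,v]\rangle$. On $\mathfrak m$ put $[u,v]_{\mathfrak m}=([u,v])_{\mathfrak m}$. A smooth bivector field $\pi$ on $G/H$ is $G$-invariant if $\wedge^2(T_x\lambda_g)\,\pi_x=\pi_{g x}$ for all $g\in G$, $x\in G/H$, and Poisson if $\{f,k\}=\pi(df,dk)$ satisfies the Jacobi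 identity on $C^\infty(G/H)$. 1. There is a bijection $\pi\mapsto r$ from the set of $G$-invariant Poisson bivector fields on $G/H$ onto the set of those $r\in(\wedge^2\mathfrak m)^H$ that satisfy $$[\alpha,\beta]_r^\#=[\alpha^\#,\beta^\#]_{\mathfrak m}\qquad\text{for all }\alpha,\beta\in\mathfrak m^*,\tag{$*$}$$ where $r$ is determined by $\pi_{\bar e}=\wedge^2(T_ep|_{\mathfrak m})\,r$. 2. $(\mathfrak m^H,[\cdot,\cdot]_{\mathfrak m})$ is a Lie algebra, and for every $r\in(\wedge^2\mathfrak m)^H$ satisfying $(*)$, $((\mathfrak m^*)^H,[\cdot,\cdot]_r)$ is a Lie algebra and $r_\#$ restricts to a Lie algebra morphism $((\mathfrak m^*)^H,[\cdot,\cdot]_r)\to(\mathfrak m^H,[\cdot,\cdot]_{\mathfrak m})$. -/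

import Mathlib

open scoped Manifold ContDiff

noncomputable section

/-! ### Bivectors on a vector space -/

/-- Bivectors on a (finite-dimensional) real vector space `V`, i.e. elements of `⋀² V`, regarded as
alternating bilinear forms on the dual space `V*`. -/
def Bivector (V : Type*) [AddCommGroup V] [Module ℝ V] :
    Submodule ℝ (LinearMap.BilinForm ℝ (Module.Dual ℝ V)) where
  carrier := {r | r.IsAlt}
  zero_mem' := fun α => by simp
  add_mem' := fun {r s} hr hs α => by simp [hr α, hs α]
  smul_mem' := fun c r hr α => by simp [hr α]

namespace Bivector

variable {V W : Type*} [AddCommGroup V] [Module ℝ V] [AddCommGroup W] [Module ℝ W]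

/-- The push-forward `⋀² φ : ⋀² V → ⋀² W` along a linear map `φ : V → W`:
`(⋀² φ r)(α, β) = r(φ* α, φ* β)`. -/
def map (φ : V →ₗ[ℝ] W) (r : Bivector V) : Bivector W :=
  ⟨r.1.compl₁₂ φ.dualMap φ.dualMap, fun α => r.2 (φ.dualMap α)⟩

/-- The map `r_# : V* → V`, `α ↦ α^#`, where `⟨β, α^#⟩ = r(α, β)` for all `β`. -/
def sharp [FiniteDimensional ℝ V] (r : Bivector V) : Module.Dual ℝ V →ₗ[ℝ] V :=
  (Module.evalEquiv ℝ V).symm.toLinearMap ∘ₗ r.1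

theorem dual_sharp [FiniteDimensional ℝ V] (r : Bivector V) (α β : Module.Dual ℝ V) :
    β (sharp r α) = r.1 α β := by
  simp [sharp]

end Bivector

/-! ### Brackets on subspaces -/

/-- The bilinear map `b` restricts to a Lie bracket on the subspace `W`. -/
structure IsLieBracketOn {V : Type*} [AddCommGroup V] [Module ℝ V]
    (b : V →ₗ[ℝ] V →ₗ[ℝ] V) (W : Submodule ℝ V) : Prop where
  mem : ∀ x ∈ W, ∀ y ∈ W, b x y ∈ W
  self : ∀ x ∈ W, b x x = 0
  jacobi : ∀ x ∈ W, ∀ y ∈ W, ∀ z ∈ W, b x (b y z) + b y (b z x) + b z (b x y) = 0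

/-- The linear map `φ` restricts to a map `W → W'` that carries the bracket `b` to the
bracket `b'`. -/
structure IsLieMorphismOn {V V' : Type*} [AddCommGroup V] [Module ℝ V] [AddCommGroup V']
    [Module ℝ V'] (φ : V →ₗ[ℝ] V') (b : V →ₗ[ℝ] V →ₗ[ℝ] V) (W : Submodule ℝ V)
    (b' : V' →ₗ[ℝ] V' →ₗ[ℝ] V') (W' : Submodule ℝ V') : Prop where
  mem : ∀ x ∈ W, φ x ∈ W'
  map_bracket : ∀ x ∈ W, ∀ y ∈ W, φ (b x y) = b' (φ x) (φ y)

/-! ### Bivector fields on a manifold -/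

section Manifold

variable {F : Type*} [NormedAddCommGroup F] [NormedSpace ℝ F]
  {M : Type*} [TopologicalSpace M] [ChartedSpace F M]

/-- The differential `(df)_x : T_x M → ℝ` of a real function on `M`. -/
def differential (f : M → ℝ) (x : M) : Module.Dual ℝ (TangentSpace 𝓘(ℝ, F) x) :=
  (mvfderiv 𝓘(ℝ, F) f x).toLinearMap

/-- The tangent map `T_x λ_g : T_x M → T_{g x} M` of the translation `λ_g : x ↦ g x`. -/
def tangentSMul {G : Type*} [SMul G M] (g : G) (x : M) :
    TangentSpace 𝓘(ℝ, F) x →ₗ[ℝ] TangentSpace 𝓘(ℝ, F) (g • x) :=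
  (mfderiv 𝓘(ℝ, F) 𝓘(ℝ, F) (fun y : M => g • y) x).toLinearMap

variable (F M) in
/-- A smooth bivector field `π` on `M`; smoothness says that `π(df, dg)` is smooth on every open
set on which `f` and `g` are (for coordinate functions: the components of `π` are smooth). -/
structure BivectorField where
  toFun : ∀ x : M, Bivector (TangentSpace 𝓘(ℝ, F) x)
  smooth : ∀ U : Set M, IsOpen U → ∀ f g : M → ℝ,
    ContMDiffOn 𝓘(ℝ, F) 𝓘(ℝ, ℝ) ∞ f U → ContMDiffOn 𝓘(ℝ, F) 𝓘(ℝ, ℝ) ∞ g U →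
      ContMDiffOn 𝓘(ℝ, F) 𝓘(ℝ, ℝ) ∞
        (fun x => (toFun x).1 (differential f x) (differential g x)) U

namespace BivectorField

/-- `{f, g} = π(df, dg)`. -/
def bracket (π : BivectorField F M) (f g : M → ℝ) : M → ℝ :=
  fun x => (π.toFun x).1 (differential f x) (differential g x)

/-- `π` is a Poisson bivector field: `{f, g} = π(df, dg)` satisfies the Jacobi identity
on `C^∞(M)`. -/
def IsPoisson (π : BivectorField F M) : Prop :=
  ∀ f g h : M → ℝ, ContMDiff 𝓘(ℝ, F) 𝓘(ℝ, ℝ) ∞ f → ContMDiff 𝓘(ℝ, F) 𝓘(ℝ, ℝ) ∞ g →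
    ContMDiff 𝓘(ℝ, F) 𝓘(ℝ, ℝ) ∞ h →
      π.bracket f (π.bracket g h) + π.bracket g (π.bracket h f) + π.bracket h (π.bracket f g) = 0

/-- `π` is invariant under the action of `G`: `⋀²(T_x λ_g) π_x = π_{g x}`. -/
def IsInvariant (G : Type*) [SMul G M] (π : BivectorField F M) : Prop :=
  ∀ (g : G) (x : M), Bivector.map (tangentSMul g x) (π.toFun x) = π.toFun (g • x)

end BivectorField

end Manifold

/-! ### Lie groups and reductive pairs -/

section LieGroup

instance : ENat.LEInfty (minSmoothness ℝ 3) where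
  out := by
    rw [minSmoothness_of_isRCLikeNormedField]
    exact ENat.LEInfty.out

variable {E : Type*} [NormedAddCommGroup E] [NormedSpace ℝ E]
  {G : Type*} [TopologicalSpace G] [ChartedSpace E G] [Group G]

/-- The adjoint action `Ad_a : 𝔤 → 𝔤`, the tangent map at the identity of `x ↦ a x a⁻¹`. -/
def lieAd (a : G) : GroupLieAlgebra 𝓘(ℝ, E) G →ₗ[ℝ] GroupLieAlgebra 𝓘(ℝ, E) G :=
  (mfderiv 𝓘(ℝ, E) 𝓘(ℝ, E) (fun x : G => a * x * a⁻¹) 1).toLinearMap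

/-- The Lie algebra `𝔥` of a closed subgroup `H`: the vectors `u ∈ 𝔤` such that `exp(tu) ∈ H` for
all real `t`, where `t ↦ exp(tu)` is the integral curve of the left-invariant field of `u` that
starts at the identity. (For a closed subgroup these vectors form a linear subspace; the span makes
`𝔥` a subspace by construction.) -/
def subgroupLieAlgebra (H : Subgroup G) : Submodule ℝ (GroupLieAlgebra 𝓘(ℝ, E) G) :=
  Submodule.span ℝ {u | ∃ γ : ℝ → G, γ 0 = 1 ∧
    IsMIntegralCurve (I := 𝓘(ℝ, E)) γ (mulInvariantVectorField u) ∧ ∀ t, γ t ∈ H}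

variable (E) in
/-- A reductive decomposition of the pair `(G, H)`: a subspace `𝔪` with `𝔤 = 𝔥 ⊕ 𝔪` and
`Ad_a(𝔪) = 𝔪` for all `a ∈ H`. -/
structure ReductiveDecomposition (H : Subgroup G) where
  𝔪 : Submodule ℝ (GroupLieAlgebra 𝓘(ℝ, E) G)
  isCompl : IsCompl (subgroupLieAlgebra H) 𝔪
  map_lieAd : ∀ a ∈ H, 𝔪.map (lieAd a) = 𝔪

instance [FiniteDimensional ℝ E] : FiniteDimensional ℝ (GroupLieAlgebra 𝓘(ℝ, E) G) :=
  inferInstanceAs (FiniteDimensional ℝ E)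

namespace ReductiveDecomposition

variable {H : Subgroup G} (D : ReductiveDecomposition E H)

/-- The projection `u ↦ u_𝔪` of `𝔤 = 𝔥 ⊕ 𝔪` onto `𝔪`. -/
def proj : GroupLieAlgebra 𝓘(ℝ, E) G →ₗ[ℝ] D.𝔪 :=
  D.𝔪.projectionOnto (subgroupLieAlgebra H) D.isCompl.symm

/-- The action `Ad_a : 𝔪 → 𝔪` of `a ∈ H`. -/
def adM (a : H) : D.𝔪 →ₗ[ℝ] D.𝔪 :=
  (lieAd (a : G)).restrict fun _ hu => D.map_lieAd a a.2 ▸ Submodule.mem_map_of_mem hu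

/-- `𝔪^H`. -/
def invariants : Submodule ℝ D.𝔪 where
  carrier := {u | ∀ a : H, D.adM a u = u}
  zero_mem' := fun a => map_zero _
  add_mem' := fun {u v} hu hv a => by rw [map_add, hu a, hv a]
  smul_mem' := fun c u hu a => by rw [map_smul, hu a]

/-- `(𝔪*)^H`, the covectors `α` with `Ad_a* α = α ∘ Ad_a = α` for all `a ∈ H`. -/
def dualInvariants : Submodule ℝ (Module.Dual ℝ D.𝔪) where
  carrier := {α | ∀ a : H, (D.adM a).dualMap α = α}
  zero_mem' := fun a => map_zero _
  add_mem' := fun {u v} hu hv a => by rw [map_add, hu a, hv a]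
  smul_mem' := fun c u hu a => by rw [map_smul, hu a]

/-- `(⋀² 𝔪)^H`: `r(Ad_a* α, Ad_a* β) = r(α, β)` for all `a ∈ H`. -/
def bivectorInvariants : Set (Bivector D.𝔪) :=
  {r | ∀ a : H, Bivector.map (D.adM a) r = r}

variable [FiniteDimensional ℝ E] [LieGroup 𝓘(ℝ, E) ∞ G]

/-- The bracket `(u, v) ↦ [u, v]_𝔪` on `𝔪`. -/
def bracketM : D.𝔪 →ₗ[ℝ] D.𝔪 →ₗ[ℝ] D.𝔪 :=
  haveI := FiniteDimensional.complete ℝ E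
  LinearMap.mk₂ ℝ (fun u v => D.proj ⁅(u : GroupLieAlgebra 𝓘(ℝ, E) G), (v : GroupLieAlgebra 𝓘(ℝ, E) G)⁆)
    (fun u u' v => by simp) (fun c u v => by simp) (fun u v v' => by simp) (fun c u v => by simp)

/-- The coadjoint operator `ad_u* : 𝔤* → 𝔤*`, `⟨ad_u* η, v⟩ = ⟨η, [u, v]⟩`. -/
def coad (u : GroupLieAlgebra 𝓘(ℝ, E) G) :
    Module.Dual ℝ (GroupLieAlgebra 𝓘(ℝ, E) G) →ₗ[ℝ] Module.Dual ℝ (GroupLieAlgebra 𝓘(ℝ, E) G) :=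
  haveI := FiniteDimensional.complete ℝ E
  (LieAlgebra.ad ℝ (GroupLieAlgebra 𝓘(ℝ, E) G) u).dualMap

/-- The bracket `[α, β]_r = (-ad_{α^#}* β̃ + ad_{β^#}* α̃)|_𝔪` on `𝔪*`, where `α̃ = α ∘ proj` is the
extension of `α` to `𝔤` that vanishes on `𝔥`. -/
def dualBracket (r : Bivector D.𝔪) :
    Module.Dual ℝ D.𝔪 →ₗ[ℝ] Module.Dual ℝ D.𝔪 →ₗ[ℝ] Module.Dual ℝ D.𝔪 :=
  LinearMap.mk₂ ℝ
    (fun α β => (-coad (Bivector.sharp r α : GroupLieAlgebra 𝓘(ℝ, E) G) (D.proj.dualMap β)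
      + coad (Bivector.sharp r β : GroupLieAlgebra 𝓘(ℝ, E) G) (D.proj.dualMap α)) ∘ₗ D.𝔪.subtype)
    (fun α α' β => by ext v; simp [coad]; ring)
    (fun c α β => by ext v; simp [coad]; ring)
    (fun α β β' => by ext v; simp [coad]; ring)
    (fun c α β => by ext v; simp [coad]; ring)

/-- The equation `[α, β]_r^# = [α^#, β^#]_𝔪` for all `α, β ∈ 𝔪*`. -/
def IsYangBaxter (r : Bivector D.𝔪) : Prop :=
  ∀ α β : Module.Dual ℝ D.𝔪, Bivector.sharp r (D.dualBracket r α β) =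
    D.bracketM (Bivector.sharp r α) (Bivector.sharp r β)

end ReductiveDecomposition

variable {F : Type*} [NormedAddCommGroup F] [NormedSpace ℝ F]

/-- The tangent map `T_e p : 𝔤 → T_ē (G/H)` of the projection `p : G → G/H`. -/
def tangentProj (H : Subgroup G) [ChartedSpace F (G ⧸ H)] :
    GroupLieAlgebra 𝓘(ℝ, E) G →ₗ[ℝ] TangentSpace 𝓘(ℝ, F) ((1 : G) : G ⧸ H) :=
  (mfderiv 𝓘(ℝ, E) 𝓘(ℝ, F) (fun g : G => (g : G ⧸ H)) 1).toLinearMap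

end LieGroup

end

/-! Everything is lifted to `G`. A function `f` on `G/H` becomes a right `H`-invariant function on
`G`, and `ldiff D.emb` records its derivatives along the left-invariant fields `X_w`, `w ∈ 𝔪`. Since
`ker T_e p = 𝔥` (`tangentProj_eq_zero_iff`), `T_e p` is an isomorphism on `𝔪`. An invariant field
with value `r` at the base point then satisfies `{f, k}(gH) = r(ldiff f g, ldiff k g)` with constant
`r`. Invariance under the stabiliser is `Ad(H)`-invariance of `r`. Conversely this makes the
translates of `r` independent of coset representatives, and smoothness descends along the
submersion.

For the Jacobi identity, write `α, β, γ` for the covectors of `f, k, l` at `g`. The Leibniz rule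
(`ldiff_apply_ldiff`) gives `{f, {k, l}} = X_{α^#} X_{β^#} l - X_{α^#} X_{γ^#} k` at `g`, with the
vectors frozen at `g`. In the cyclic sum the second derivatives pair into commutators, and lifted
functions see only the `𝔪`-part of a bracket. The Jacobiator is therefore `γ([α^#, β^#]_𝔪)` plus
cyclic terms (`jacobiator_apply`). Bump functions realise all covectors at the base point, so
Poisson means that this sum vanishes identically, which is `(*)` paired with `γ`
(`isYangBaxter_iff`).

For the second part, differentiating `Ad(H)`-invariance along curves in `H` gives `[𝔥, u] = 0` for
`u ∈ 𝔪^H` and `α([x, v]_𝔪) = 0` for `x ∈ 𝔥`, `α ∈ (𝔪*)^H`. Hence dropping `𝔥`-components does not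
harm the Jacobi identities, and `(*)` is itself the morphism property.

Tangent spaces are definitionally the model space. Tangent maps are therefore stated as maps of
model spaces, which permits rewriting of base points. -/

noncomputable section
open Set Filter Topology VectorField

/-! ### Calculus of tangent maps between model spaces. -/

section TangentMap

variable {E : Type*} [NormedAddCommGroup E] [NormedSpace ℝ E]
  {M : Type*} [TopologicalSpace M] [ChartedSpace E M]
  {E' : Type*} [NormedAddCommGroup E'] [NormedSpace ℝ E']
  {M' : Type*} [TopologicalSpace M'] [ChartedSpace E' M']
  {E'' : Type*} [NormedAddCommGroup E''] [NormedSpace ℝ E'']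
  {M'' : Type*} [TopologicalSpace M''] [ChartedSpace E'' M'']

/-- The tangent map of `φ` at `x`, as a map between the model spaces. -/
def tmap (φ : M → M') (x : M) : E →L[ℝ] E' := mfderiv 𝓘(ℝ, E) 𝓘(ℝ, E') φ x

theorem tmap_comp {f : M' → M''} {φ : M → M'} (x : M)
    (hf : MDifferentiableAt 𝓘(ℝ, E') 𝓘(ℝ, E'') f (φ x))
    (hφ : MDifferentiableAt 𝓘(ℝ, E) 𝓘(ℝ, E') φ x) :
    (tmap (f ∘ φ) x : E →L[ℝ] E'') = (tmap f (φ x) : E' →L[ℝ] E'').comp (tmap φ x) :=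
  mfderiv_comp x hf hφ

theorem tmap_congr {f g : M → M'} {x : M} (h : f =ᶠ[𝓝 x] g) :
    (tmap f x : E →L[ℝ] E') = tmap g x :=
  h.mfderiv_eq

theorem tmap_id (x : M) : (tmap (id : M → M) x : E →L[ℝ] E) = ContinuousLinearMap.id ℝ E :=
  mfderiv_id

theorem tmap_const (c : M') (x : M) : (tmap (fun _ : M => c) x : E →L[ℝ] E') = 0 :=
  mfderiv_const

theorem tmap_eq_fderiv (f : E → E') (x : E) : (tmap f x : E →L[ℝ] E') = fderiv ℝ f x :=
  mfderiv_eq_fderiv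

theorem tmap_mul {f g : M → ℝ} {x : M} (hf : MDifferentiableAt 𝓘(ℝ, E) 𝓘(ℝ, ℝ) f x)
    (hg : MDifferentiableAt 𝓘(ℝ, E) 𝓘(ℝ, ℝ) g x) :
    (tmap (fun y => f y * g y) x : E →L[ℝ] ℝ) = f x • tmap g x + g x • tmap f x :=
  mvfderiv_mul hf hg

theorem tmap_const_mul {f : M → ℝ} {x : M} (hf : MDifferentiableAt 𝓘(ℝ, E) 𝓘(ℝ, ℝ) f x)
    (c : ℝ) : (tmap (fun y => c * f y) x : E →L[ℝ] ℝ) = c • tmap f x := by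
  rw [tmap_mul mdifferentiableAt_const hf, tmap_const, smul_zero, add_zero]

theorem tmap_sum {ι : Type*} (s : Finset ι) {f : ι → M → ℝ} {x : M}
    (hf : ∀ i ∈ s, MDifferentiableAt 𝓘(ℝ, E) 𝓘(ℝ, ℝ) (f i) x) :
    (tmap (fun y => ∑ i ∈ s, f i y) x : E →L[ℝ] ℝ) = ∑ i ∈ s, tmap (f i) x := by
  classical
  have key : MDifferentiableAt 𝓘(ℝ, E) 𝓘(ℝ, ℝ) (fun y => ∑ i ∈ s, f i y) x ∧
      (tmap (fun y => ∑ i ∈ s, f i y) x : E →L[ℝ] ℝ) = ∑ i ∈ s, tmap (f i) x := by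
    induction s using Finset.induction_on with
    | empty => exact ⟨by simpa using mdifferentiableAt_const, by simpa using tmap_const (0 : ℝ) x⟩
    | insert a s ha ih =>
      obtain ⟨h1, h2⟩ := ih fun i hi => hf i (Finset.mem_insert_of_mem hi)
      have ha' := hf a (Finset.mem_insert_self a s)
      simp only [Finset.sum_insert ha]
      refine ⟨ha'.add h1, ?_⟩
      rw [← h2]
      exact mvfderiv_add ha' h1
  exact key.2

/-- In the chart at the point, the tangent map is the Fréchet derivative. -/
theorem tmap_eq_fderiv_extChartAt {f : M → E'} {x : M}
    (hf : MDifferentiableAt 𝓘(ℝ, E) 𝓘(ℝ, E') f x) :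
    (tmap f x : E →L[ℝ] E')
      = fderiv ℝ (f ∘ (extChartAt 𝓘(ℝ, E) x).symm) (extChartAt 𝓘(ℝ, E) x x) := by
  have h := hf.mvfderiv
  simp only [modelWithCornersSelf_coe, range_id, fderivWithin_univ] at h
  exact h

end TangentMap

/-! ### Partial differentials on a product of manifolds. -/

section Partial

variable {E : Type*} [NormedAddCommGroup E] [NormedSpace ℝ E]
  {M : Type*} [TopologicalSpace M] [ChartedSpace E M] [IsManifold 𝓘(ℝ, E) ∞ M]
  {E' : Type*} [NormedAddCommGroup E'] [NormedSpace ℝ E']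
  {M' : Type*} [TopologicalSpace M'] [ChartedSpace E' M'] [IsManifold 𝓘(ℝ, E') ∞ M']

theorem contMDiffAt_extChartAt_symm_self (x : M) :
    ContMDiffAt 𝓘(ℝ, E) 𝓘(ℝ, E) ∞ (extChartAt 𝓘(ℝ, E) x).symm (extChartAt 𝓘(ℝ, E) x x) :=
  (contMDiffOn_extChartAt_symm x).contMDiffAt (extChartAt_target_mem_nhds x)

theorem eventually_mdifferentiableAt_partial {F : M × M' → ℝ} {x₀ : M} {y₀ : M'}
    (hF : ContMDiffAt (𝓘(ℝ, E).prod 𝓘(ℝ, E')) 𝓘(ℝ, ℝ) ∞ F (x₀, y₀)) :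
    ∀ᶠ x in 𝓝 x₀, MDifferentiableAt 𝓘(ℝ, E') 𝓘(ℝ, ℝ) (fun y => F (x, y)) y₀ := by
  -- The order is lowered to `1` because regularity of finite order at a point spreads to a
  -- neighbourhood.
  have h1 : ContMDiffAt (𝓘(ℝ, E).prod 𝓘(ℝ, E')) 𝓘(ℝ, ℝ) 1 F (x₀, y₀) := hF.of_le (by simp)
  have : IsManifold 𝓘(ℝ, E) 1 M := .of_le (n := ∞) (by simp)
  have : IsManifold 𝓘(ℝ, E') 1 M' := .of_le (n := ∞) (by simp)
  have h2 := (contMDiffAt_iff_contMDiffAt_nhds (by simp)).1 h1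
  have hc : ContinuousAt (fun x : M => (x, y₀)) x₀ := by fun_prop
  filter_upwards [hc.eventually h2] with x hx
  have : ContMDiffAt 𝓘(ℝ, E') 𝓘(ℝ, ℝ) 1 (fun y => F (x, y)) y₀ :=
    hx.comp y₀ (contMDiffAt_const.prodMk contMDiffAt_id)
  exact this.mdifferentiableAt (by simp)

/-- The partial differentials of a smooth function of two variables depend smoothly on the
parameter. -/
theorem contMDiffAt_tmap_partial {F : M × M' → ℝ} {x₀ : M} {y₀ : M'}
    (hF : ContMDiffAt (𝓘(ℝ, E).prod 𝓘(ℝ, E')) 𝓘(ℝ, ℝ) ∞ F (x₀, y₀)) (v : E') :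
    ContMDiffAt 𝓘(ℝ, E) 𝓘(ℝ, ℝ) ∞
      (fun x => (tmap (fun y => F (x, y)) y₀ : E' →L[ℝ] ℝ) v) x₀ := by
  have h1 : ContMDiffAt (𝓘(ℝ, E).prod 𝓘(ℝ, E')) 𝓘(ℝ, ℝ) ∞
      (Function.uncurry fun (x : M) (z : E') => F (x, (extChartAt 𝓘(ℝ, E') y₀).symm z))
      (x₀, extChartAt 𝓘(ℝ, E') y₀ y₀) := by
    refine ContMDiffAt.comp (g := F) (f := fun q : M × E' =>
      (q.1, (extChartAt 𝓘(ℝ, E') y₀).symm q.2)) _ (by simpa using hF) ?_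
    exact contMDiffAt_fst.prodMk
      ((contMDiffAt_extChartAt_symm_self y₀).comp (x₀, extChartAt 𝓘(ℝ, E') y₀ y₀) contMDiffAt_snd)
  have h2 := ContMDiffAt.mfderiv_apply (m := ∞) (x₀ := x₀) _ (fun _ => extChartAt 𝓘(ℝ, E') y₀ y₀)
    id (fun _ => v) h1 contMDiffAt_const contMDiffAt_id contMDiffAt_const (by simp)
  refine h2.congr_of_eventuallyEq ?_
  filter_upwards [eventually_mdifferentiableAt_partial hF] with x hx
  rw [tmap_eq_fderiv_extChartAt hx, ← tmap_eq_fderiv]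
  exact (congrArg (fun l : M → E' →L[ℝ] ℝ => l x v)
    (inTangentCoordinates_model_space (I := 𝓘(ℝ, E')) (I' := 𝓘(ℝ, ℝ))
      (fun _ : M => extChartAt 𝓘(ℝ, E') y₀ y₀) _ (fun x : M =>
        (tmap ((fun y => F (x, y)) ∘ (extChartAt 𝓘(ℝ, E') y₀).symm) (extChartAt 𝓘(ℝ, E') y₀ y₀)
          : E' →L[ℝ] ℝ)) x₀)).symm

/-- Symmetry of the mixed partial derivatives on a product of manifolds. -/
theorem tmap_partial_comm {F : M × M' → ℝ} {x₀ : M} {y₀ : M'}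
    (hF : ContMDiffAt (𝓘(ℝ, E).prod 𝓘(ℝ, E')) 𝓘(ℝ, ℝ) ∞ F (x₀, y₀)) (v : E) (w : E') :
    (tmap (fun x => (tmap (fun y => F (x, y)) y₀ : E' →L[ℝ] ℝ) w) x₀ : E →L[ℝ] ℝ) v
      = (tmap (fun y => (tmap (fun x => F (x, y)) x₀ : E →L[ℝ] ℝ) v) y₀ : E' →L[ℝ] ℝ) w := by
  have hF' : ContMDiffAt (𝓘(ℝ, E').prod 𝓘(ℝ, E)) 𝓘(ℝ, ℝ) ∞ (fun q : M' × M => F (q.2, q.1))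
      (y₀, x₀) :=
    ContMDiffAt.comp _ hF (contMDiffAt_snd.prodMk contMDiffAt_fst)
  set φ := extChartAt 𝓘(ℝ, E) x₀ with hφ
  set ψ := extChartAt 𝓘(ℝ, E') y₀ with hψ
  set K : E × E' → ℝ := fun q => F (φ.symm q.1, ψ.symm q.2) with hK
  have hKs : ContDiffAt ℝ 2 K (φ x₀, ψ y₀) := by
    have : ContMDiffAt (𝓘(ℝ, E).prod 𝓘(ℝ, E')) 𝓘(ℝ, ℝ) ∞ K (φ x₀, ψ y₀) := by
      refine ContMDiffAt.comp (g := F) (f := fun q : E × E' => (φ.symm q.1, ψ.symm q.2)) _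
        (by simpa [hφ, hψ] using hF) ?_
      exact ((contMDiffAt_extChartAt_symm_self x₀).comp (φ x₀, ψ y₀) contMDiffAt_fst).prodMk
        ((contMDiffAt_extChartAt_symm_self y₀).comp (φ x₀, ψ y₀) contMDiffAt_snd)
    rw [modelWithCornersSelf_prod.symm, ← chartedSpaceSelf_prod.symm] at this
    exact this.contDiffAt.of_le (WithTop.coe_le_coe.2 le_top)
  have hsymm : IsSymmSndFDerivAt ℝ K (φ x₀, ψ y₀) :=
    hKs.isSymmSndFDerivAt (by simp [minSmoothness_of_isRCLikeNormedField])
  have hd : DifferentiableAt ℝ (fderiv ℝ K) (φ x₀, ψ y₀) :=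
    (hKs.fderiv_right (m := 1) (by norm_num)).differentiableAt (by simp)
  have hev : ∀ᶠ q in 𝓝 (φ x₀, ψ y₀), DifferentiableAt ℝ K q := by
    have := (hKs.of_le (m := 1) (by norm_num)).eventually (by simp)
    filter_upwards [this] with q hq using hq.differentiableAt (by simp)
  have hL : ∀ᶠ z in 𝓝 (φ x₀),
      (tmap (fun y => F (φ.symm z, y)) y₀ : E' →L[ℝ] ℝ) w = fderiv ℝ K (z, ψ y₀) (0, w) := by
    have hc : Tendsto φ.symm (𝓝 (φ x₀)) (𝓝 x₀) := by
      simpa only [ContinuousAt, extChartAt_to_inv] using continuousAt_extChartAt_symm (I := 𝓘(ℝ, E)) x₀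
    have hc2 : ContinuousAt (fun z : E => (z, ψ y₀)) (φ x₀) := by fun_prop
    filter_upwards [hc.eventually (eventually_mdifferentiableAt_partial hF), hc2.eventually hev]
      with z hz hz2
    rw [tmap_eq_fderiv_extChartAt hz]
    have : HasFDerivAt (fun u : E' => (z, u)) (ContinuousLinearMap.inr ℝ E E') (ψ y₀) :=
      hasFDerivAt_prodMk_right z (ψ y₀)
    have h3 := (hz2.hasFDerivAt.comp (ψ y₀) this).fderiv
    have h4 : ((fun y => F (φ.symm z, y)) ∘ ψ.symm) = K ∘ fun u : E' => (z, u) := rfl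
    rw [h4, h3]
    simp
  have hR : ∀ᶠ z in 𝓝 (ψ y₀),
      (tmap (fun x => F (x, ψ.symm z)) x₀ : E →L[ℝ] ℝ) v = fderiv ℝ K (φ x₀, z) (v, 0) := by
    have hc : Tendsto ψ.symm (𝓝 (ψ y₀)) (𝓝 y₀) := by
      simpa only [ContinuousAt, extChartAt_to_inv] using continuousAt_extChartAt_symm (I := 𝓘(ℝ, E')) y₀
    have hc2 : ContinuousAt (fun z : E' => (φ x₀, z)) (ψ y₀) := by fun_prop
    filter_upwards [hc.eventually (eventually_mdifferentiableAt_partial hF'), hc2.eventually hev]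
      with z hz hz2
    rw [tmap_eq_fderiv_extChartAt hz]
    have : HasFDerivAt (fun u : E => (u, z)) (ContinuousLinearMap.inl ℝ E E') (φ x₀) :=
      hasFDerivAt_prodMk_left (φ x₀) z
    have h3 := (hz2.hasFDerivAt.comp (φ x₀) this).fderiv
    have h4 : ((fun x => F (x, ψ.symm z)) ∘ φ.symm) = K ∘ fun u : E => (u, z) := rfl
    rw [h4, h3]
    simp
  rw [tmap_eq_fderiv_extChartAt ((contMDiffAt_tmap_partial hF w).mdifferentiableAt (by simp)),
    tmap_eq_fderiv_extChartAt ((contMDiffAt_tmap_partial hF' v).mdifferentiableAt (by simp))]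
  have eL : ((fun x => (tmap (fun y => F (x, y)) y₀ : E' →L[ℝ] ℝ) w) ∘ φ.symm)
      =ᶠ[𝓝 (φ x₀)] fun z => fderiv ℝ K (z, ψ y₀) (0, w) := hL
  have eR : ((fun y => (tmap (fun x => F (x, y)) x₀ : E →L[ℝ] ℝ) v) ∘ ψ.symm)
      =ᶠ[𝓝 (ψ y₀)] fun z => fderiv ℝ K (φ x₀, z) (v, 0) := hR
  have h5 : HasFDerivAt (fun z => fderiv ℝ K (z, ψ y₀) (0, w))
      (((fderiv ℝ (fderiv ℝ K) (φ x₀, ψ y₀)).comp (ContinuousLinearMap.inl ℝ E E')).flip (0, w))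
      (φ x₀) := by
    have := hd.hasFDerivAt.comp (φ x₀) (hasFDerivAt_prodMk_left (𝕜 := ℝ) (φ x₀) (ψ y₀))
    exact (this.clm_apply (hasFDerivAt_const (0, w) _)).congr_fderiv (by ext; simp)
  have h6 : HasFDerivAt (fun z => fderiv ℝ K (φ x₀, z) (v, 0))
      (((fderiv ℝ (fderiv ℝ K) (φ x₀, ψ y₀)).comp (ContinuousLinearMap.inr ℝ E E')).flip (v, 0))
      (ψ y₀) := by
    have := hd.hasFDerivAt.comp (ψ y₀) (hasFDerivAt_prodMk_right (𝕜 := ℝ) (φ x₀) (ψ y₀))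
    exact (this.clm_apply (hasFDerivAt_const (v, 0) _)).congr_fderiv (by ext; simp)
  rw [← hφ, ← hψ, eL.fderiv_eq, eR.fderiv_eq, h5.fderiv, h6.fderiv]
  simpa using hsymm.eq (v, 0) (0, w)

end Partial

/-! ### The bracket of vector fields as a commutator of derivations. -/

section Bracket

variable {E : Type*} [NormedAddCommGroup E] [NormedSpace ℝ E]
  {M : Type*} [TopologicalSpace M] [ChartedSpace E M]

theorem mlieBracket_eq_inverse_lieBracket (V W : Π y : M, TangentSpace 𝓘(ℝ, E) y) (x : M) :
    mlieBracket 𝓘(ℝ, E) V W x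
      = (tmap (extChartAt 𝓘(ℝ, E) x) x : E →L[ℝ] E).inverse
        (lieBracket ℝ
          (fun y : E => (tmap (extChartAt 𝓘(ℝ, E) x).symm y : E →L[ℝ] E).inverse
            (V ((extChartAt 𝓘(ℝ, E) x).symm y)))
          (fun y : E => (tmap (extChartAt 𝓘(ℝ, E) x).symm y : E →L[ℝ] E).inverse
            (W ((extChartAt 𝓘(ℝ, E) x).symm y)))
          (extChartAt 𝓘(ℝ, E) x x)) := by
  have h := mlieBracketWithin_apply (I := 𝓘(ℝ, E)) (V := V) (W := W) (s := univ) (x₀ := x)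
  rw [mlieBracketWithin_univ] at h
  simp only [modelWithCornersSelf_coe, range_id, preimage_univ, inter_univ,
    mpullbackWithin_univ] at h
  exact h.trans (congrArg _ (congrFun lieBracketWithin_univ _))

/-- Tangent maps are written in the preferred chart at the point, and in that chart the chart itself
is the identity. -/
theorem tmap_extChartAt_self (x : M) :
    (tmap (extChartAt 𝓘(ℝ, E) x) x : E →L[ℝ] E) = ContinuousLinearMap.id ℝ E := by
  rw [tmap_eq_fderiv_extChartAt ((contMDiffAt_extChartAt (n := ∞)).mdifferentiableAt (by simp))]
  have h2 : (extChartAt 𝓘(ℝ, E) x) ∘ (extChartAt 𝓘(ℝ, E) x).symm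
      =ᶠ[𝓝 (extChartAt 𝓘(ℝ, E) x x)] id := by
    filter_upwards [extChartAt_target_mem_nhds (I := 𝓘(ℝ, E)) x] with y hy
      using (extChartAt 𝓘(ℝ, E) x).right_inv hy
  rw [h2.fderiv_eq, fderiv_id]

variable [CompleteSpace E] [IsManifold 𝓘(ℝ, E) ∞ M]

theorem differentiableAt_mpullback_extChartAt_symm (V : Π y : M, TangentSpace 𝓘(ℝ, E) y) {x : M}
    (hV : MDifferentiableAt 𝓘(ℝ, E) 𝓘(ℝ, E).tangent
      (fun y => (⟨y, V y⟩ : TangentBundle 𝓘(ℝ, E) M)) x) :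
    DifferentiableAt ℝ (mpullback 𝓘(ℝ, E) 𝓘(ℝ, E) (extChartAt 𝓘(ℝ, E) x).symm V)
      (extChartAt 𝓘(ℝ, E) x x) := by
  have : IsManifold 𝓘(ℝ, E) 1 M := .of_le (n := ∞) (by simp)
  have : IsManifold 𝓘(ℝ, E) 2 M := .of_le (n := ∞) (WithTop.coe_le_coe.2 le_top)
  have := (hV.mdifferentiableWithinAt (s := univ)).differentiableWithinAt_mpullbackWithin_vectorField
  rw [← mpullbackWithin_univ]
  simp only [modelWithCornersSelf_coe, range_id, preimage_univ, inter_univ] at this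
  exact this.differentiableAt univ_mem

/-- Vector fields as derivations: `V (W f) - W (V f) = [V, W] f`. -/
theorem tmap_mlieBracket {V W : M → E} {x : M} {f : M → ℝ}
    (hV : MDifferentiableAt 𝓘(ℝ, E) 𝓘(ℝ, E).tangent
      (fun y => (⟨y, V y⟩ : TangentBundle 𝓘(ℝ, E) M)) x)
    (hW : MDifferentiableAt 𝓘(ℝ, E) 𝓘(ℝ, E).tangent
      (fun y => (⟨y, W y⟩ : TangentBundle 𝓘(ℝ, E) M)) x)
    (hf : ContMDiff 𝓘(ℝ, E) 𝓘(ℝ, ℝ) ∞ f)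
    (hVf : MDifferentiableAt 𝓘(ℝ, E) 𝓘(ℝ, ℝ) (fun y => (tmap f y : E →L[ℝ] ℝ) (V y)) x)
    (hWf : MDifferentiableAt 𝓘(ℝ, E) 𝓘(ℝ, ℝ) (fun y => (tmap f y : E →L[ℝ] ℝ) (W y)) x) :
    (tmap f x : E →L[ℝ] ℝ) (mlieBracket 𝓘(ℝ, E) V W x)
      = (tmap (fun y => (tmap f y : E →L[ℝ] ℝ) (W y)) x : E →L[ℝ] ℝ) (V x)
        - (tmap (fun y => (tmap f y : E →L[ℝ] ℝ) (V y)) x : E →L[ℝ] ℝ) (W x) := by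
  have : IsManifold 𝓘(ℝ, E) 1 M := .of_le (n := ∞) (by simp)
  have : IsManifold 𝓘(ℝ, E) 2 M := .of_le (n := ∞) (WithTop.coe_le_coe.2 le_top)
  have : IsManifold 𝓘(ℝ, E) (minSmoothness ℝ 2) M := by
    rw [minSmoothness_of_isRCLikeNormedField]; infer_instance
  set φ := extChartAt 𝓘(ℝ, E) x with hφ
  have hsymm_inv : ∀ y ∈ φ.target,
      (tmap φ.symm y : E →L[ℝ] E).IsInvertible := fun y hy => by
    have := isInvertible_mfderivWithin_extChartAt_symm (I := 𝓘(ℝ, E)) hy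
    simp only [modelWithCornersSelf_coe, range_id, mfderivWithin_univ] at this
    exact this
  let V' : E → E := fun y => (tmap φ.symm y : E →L[ℝ] E).inverse (V (φ.symm y))
  let W' : E → E := fun y => (tmap φ.symm y : E →L[ℝ] E).inverse (W (φ.symm y))
  have hbr : mlieBracket 𝓘(ℝ, E) V W x
      = (tmap φ x : E →L[ℝ] E).inverse (lieBracket ℝ V' W' (φ x)) :=
    mlieBracket_eq_inverse_lieBracket V W x
  have hV' : DifferentiableAt ℝ V' (φ x) := differentiableAt_mpullback_extChartAt_symm V hV
  have hW' : DifferentiableAt ℝ W' (φ x) := differentiableAt_mpullback_extChartAt_symm W hW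
  set k : E → ℝ := f ∘ φ.symm with hk
  have hks : ContDiffAt ℝ 2 k (φ x) := by
    have : ContMDiffAt 𝓘(ℝ, E) 𝓘(ℝ, ℝ) ∞ k (φ x) :=
      ContMDiffAt.comp _ hf.contMDiffAt (contMDiffAt_extChartAt_symm_self x)
    exact this.contDiffAt.of_le (WithTop.coe_le_coe.2 le_top)
  have hsymm : IsSymmSndFDerivAt ℝ k (φ x) :=
    hks.isSymmSndFDerivAt (by simp [minSmoothness_of_isRCLikeNormedField])
  have hd : DifferentiableAt ℝ (fderiv ℝ k) (φ x) :=
    (hks.fderiv_right (m := 1) (by norm_num)).differentiableAt (by simp)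
  have htar : φ.target ∈ 𝓝 (φ x) := extChartAt_target_mem_nhds x
  have hchart : ∀ y ∈ φ.target, MDifferentiableAt 𝓘(ℝ, E) 𝓘(ℝ, E) φ.symm y := fun y hy =>
    ((contMDiffOn_extChartAt_symm (n := ∞) x).contMDiffAt
      ((isOpen_extChartAt_target x).mem_nhds hy)).mdifferentiableAt (by simp)
  have hkder : ∀ y ∈ φ.target, ∀ U : M → E,
      (tmap f (φ.symm y) : E →L[ℝ] ℝ) (U (φ.symm y))
        = fderiv ℝ k y ((tmap φ.symm y : E →L[ℝ] E).inverse (U (φ.symm y))) := fun y hy U => by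
    rw [← tmap_eq_fderiv, hk, tmap_comp y (hf.mdifferentiableAt (by simp)) (hchart y hy)]
    rw [ContinuousLinearMap.comp_apply, (hsymm_inv y hy).self_apply_inverse]
  -- Product rule for `y ↦ Dk(y)(B y)` in the chart. In the difference the two `D²k` terms cancel by
  -- symmetry, and what remains is `Dk` of the bracket of `V'` and `W'`.
  have hder : ∀ {A B : E → E} {U : M → E}, DifferentiableAt ℝ B (φ x) →
      MDifferentiableAt 𝓘(ℝ, E) 𝓘(ℝ, ℝ) (fun y => (tmap f y : E →L[ℝ] ℝ) (U y)) x →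
      (∀ y, B y = (tmap φ.symm y : E →L[ℝ] E).inverse (U (φ.symm y))) → ∀ v : E,
      (tmap (fun y => (tmap f y : E →L[ℝ] ℝ) (U y)) x : E →L[ℝ] ℝ) v
        = fderiv ℝ (fderiv ℝ k) (φ x) v (B (φ x)) + fderiv ℝ k (φ x) (fderiv ℝ B (φ x) v) := by
    intro A B U hB hU hBU v
    rw [tmap_eq_fderiv_extChartAt hU, ← hφ]
    have e : ((fun y => (tmap f y : E →L[ℝ] ℝ) (U y)) ∘ φ.symm)
        =ᶠ[𝓝 (φ x)] fun y => fderiv ℝ k y (B y) := by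
      filter_upwards [htar] with y hy
      rw [hBU, ← hkder y hy]; rfl
    rw [e.fderiv_eq, (hd.hasFDerivAt.clm_apply hB.hasFDerivAt).fderiv]
    simp [add_comm]
  have hxx : φ.symm (φ x) = x := extChartAt_to_inv x
  have hφd : MDifferentiableAt 𝓘(ℝ, E) 𝓘(ℝ, E) φ x :=
    (contMDiffAt_extChartAt (n := ∞)).mdifferentiableAt (by simp)
  have hid' : (tmap φ x : E →L[ℝ] E) = ContinuousLinearMap.id ℝ E := tmap_extChartAt_self x
  have hid : (tmap φ.symm (φ x) : E →L[ℝ] E) = ContinuousLinearMap.id ℝ E := by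
    have h1 := tmap_comp (f := φ) (φ := φ.symm) (φ x) (by rwa [hxx])
      (hchart _ (mem_of_mem_nhds htar))
    have h2 : φ ∘ φ.symm =ᶠ[𝓝 (φ x)] id := by
      filter_upwards [htar] with y hy using φ.right_inv hy
    rw [tmap_congr h2, tmap_id, hxx, hid'] at h1
    exact h1.symm
  have e1 := hder (A := V') (B := W') hW' hWf (fun y => rfl) (V x)
  have e2 := hder (A := W') (B := V') hV' hVf (fun y => rfl) (W x)
  have e3 : V' (φ x) = V x := by simp [V', hid, hxx]
  have e4 : W' (φ x) = W x := by simp [W', hid, hxx]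
  have e5 : (tmap f x : E →L[ℝ] ℝ) = fderiv ℝ k (φ x) :=
    tmap_eq_fderiv_extChartAt (hf.mdifferentiableAt (by simp))
  rw [hbr, hid', e1, e2, e5, e3, e4, lieBracket_eq]
  simp only [ContinuousLinearMap.inverse_id, ContinuousLinearMap.id_apply, map_sub, e3, e4]
  rw [hsymm.eq (V x) (W x)]
  ring

end Bracket

/-! ### Global functions with a prescribed differential at a point. -/

section Bump

variable {E : Type*} [NormedAddCommGroup E] [NormedSpace ℝ E] [FiniteDimensional ℝ E]
  {M : Type*} [TopologicalSpace M] [ChartedSpace E M] [IsManifold 𝓘(ℝ, E) ∞ M] [T2Space M]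

/-- A bump function times `l` in the chart. Identities of vectors or covectors at a point can thus
be tested on global smooth functions. -/
theorem exists_contMDiff_tmap_eq (x : M) (l : E →L[ℝ] ℝ) :
    ∃ f : M → ℝ, ContMDiff 𝓘(ℝ, E) 𝓘(ℝ, ℝ) ∞ f ∧ tmap f x = l := by
  obtain ⟨b⟩ : Nonempty (SmoothBumpFunction 𝓘(ℝ, E) x) := inferInstance
  set φ := extChartAt 𝓘(ℝ, E) x with hφ
  refine ⟨fun y => b y • l (φ y), b.contMDiff_smul ?_, ?_⟩
  · exact (l.contMDiff (n := ∞)).comp_contMDiffOn contMDiffOn_extChartAt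
  · have h : (fun y => b y • l (φ y)) =ᶠ[𝓝 x] l ∘ φ := by
      filter_upwards [b.eventuallyEq_one] with y hy
      simp [hy]
    rw [tmap_congr h]
    rw [tmap_comp x ((l.contMDiff (n := ∞)).contMDiffAt.mdifferentiableAt (by simp))
      ((contMDiffAt_extChartAt (n := ∞)).mdifferentiableAt (by simp)), tmap_eq_fderiv,
      tmap_extChartAt_self, l.fderiv, ContinuousLinearMap.comp_id]

end Bump

/-! ### Local sections of submersions and their consequences. -/

section Submersion

variable {E : Type*} [NormedAddCommGroup E] [NormedSpace ℝ E]
  {M : Type*} [TopologicalSpace M] [ChartedSpace E M]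
  {E' : Type*} [NormedAddCommGroup E'] [NormedSpace ℝ E']
  {M' : Type*} [TopologicalSpace M'] [ChartedSpace E' M']

/-- A submersion has smooth local sections. -/
theorem Manifold.IsSubmersion.exists_section {f : M → M'}
    (hf : Manifold.IsSubmersion 𝓘(ℝ, E) 𝓘(ℝ, E') ∞ f) (x : M) :
    ∃ σ : M' → M, ContMDiffAt 𝓘(ℝ, E') 𝓘(ℝ, E) ∞ σ (f x) ∧ σ (f x) = x ∧
      ∀ᶠ y in 𝓝 (f x), f (σ y) = y := by
  obtain ⟨C, _, _, hC⟩ := hf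
  obtain ⟨φ, ψ, hx, hfx, hφ, hψ, hsrc, e, hwe⟩ := hC x
  have hw : ∀ z ∈ φ.target, ψ (f (φ.symm z)) = (e z).1 := fun z hz => by
    simpa using hwe (show z ∈ (φ.extend 𝓘(ℝ, E)).target by simpa using hz)
  -- In straightened coordinates the section is the slice through `x`: the complementary coordinate
  -- stays at its value at `x`.
  set τ : E' → E := fun w => e.symm (w, (e (φ x)).2) with hτ
  have hψx : ψ (f x) = (e (φ x)).1 := by
    have := hw (φ x) (φ.map_source hx)
    rwa [φ.left_inv hx] at this
  have hτx : τ (ψ (f x)) = φ x := by simp [hτ, hψx]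
  have hτc : ContMDiff 𝓘(ℝ, E') 𝓘(ℝ, E) ∞ τ := by
    rw [contMDiff_iff_contDiff]; fun_prop
  have hψc : ContMDiffAt 𝓘(ℝ, E') 𝓘(ℝ, E') ∞ ψ (f x) :=
    contMDiffAt_of_mem_maximalAtlas hψ hfx
  have hφc : ContMDiffAt 𝓘(ℝ, E) 𝓘(ℝ, E) ∞ φ.symm (φ x) :=
    contMDiffAt_symm_of_mem_maximalAtlas hφ (φ.map_source hx)
  have hcomp : ContMDiffAt 𝓘(ℝ, E') 𝓘(ℝ, E) ∞ (τ ∘ ψ) (f x) := hτc.contMDiffAt.comp _ hψc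
  refine ⟨φ.symm ∘ τ ∘ ψ, ?_, ?_, ?_⟩
  · refine ContMDiffAt.comp _ ?_ hcomp
    simpa only [Function.comp, hτx] using hφc
  · simp [hτx, φ.left_inv hx]
  · have h1 : ∀ᶠ y in 𝓝 (f x), τ (ψ y) ∈ φ.target := by
      have : φ.target ∈ 𝓝 ((τ ∘ ψ) (f x)) := by
        simpa only [Function.comp, hτx] using φ.open_target.mem_nhds (φ.map_source hx)
      exact hcomp.continuousAt.eventually this
    filter_upwards [h1, ψ.open_source.mem_nhds hfx] with y hy hy'
    have h2 := hw _ hy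
    have h3 : (e (τ (ψ y))).1 = ψ y := by simp [hτ]
    rw [h3] at h2
    exact ψ.injOn (hsrc (φ.map_target hy)) hy' h2

theorem Manifold.IsSubmersion.tmap_surjective {f : M → M'}
    (hf : Manifold.IsSubmersion 𝓘(ℝ, E) 𝓘(ℝ, E') ∞ f) (x : M) :
    Function.Surjective (tmap f x : E →L[ℝ] E') := by
  obtain ⟨σ, hσ, hσx, hs⟩ := hf.exists_section x
  intro v
  refine ⟨(tmap σ (f x) : E' →L[ℝ] E) v, ?_⟩
  have h1 : (f ∘ σ) =ᶠ[𝓝 (f x)] id := hs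
  have h2 := tmap_comp (f x) (φ := σ) (f := f)
    (hf.contMDiff.mdifferentiableAt (I := 𝓘(ℝ, E)) (I' := 𝓘(ℝ, E')) (by simp))
    (hσ.mdifferentiableAt (by simp))
  rw [tmap_congr h1, tmap_id, hσx] at h2
  exact (congrArg (fun l : E' →L[ℝ] E' => l v) h2).symm

/-- Smoothness of a map can be tested after composition with a submersion. -/
theorem Manifold.IsSubmersion.contMDiffAt_of_comp {E'' : Type*} [NormedAddCommGroup E'']
    [NormedSpace ℝ E''] {M'' : Type*} [TopologicalSpace M''] [ChartedSpace E'' M''] {f : M → M'}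
    (hf : Manifold.IsSubmersion 𝓘(ℝ, E) 𝓘(ℝ, E') ∞ f) {g : M' → M''} {x : M}
    (h : ContMDiffAt 𝓘(ℝ, E) 𝓘(ℝ, E'') ∞ (g ∘ f) x) :
    ContMDiffAt 𝓘(ℝ, E') 𝓘(ℝ, E'') ∞ g (f x) := by
  obtain ⟨σ, hσ, hσx, hs⟩ := hf.exists_section x
  have h1 : ContMDiffAt 𝓘(ℝ, E') 𝓘(ℝ, E'') ∞ ((g ∘ f) ∘ σ) (f x) :=
    ContMDiffAt.comp _ (by rwa [hσx]) hσ
  refine h1.congr_of_eventuallyEq ?_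
  filter_upwards [hs] with y hy
  simp [hy]

end Submersion

/-! ### Derivatives of expressions in which the variable occurs twice. -/

section Diagonal

variable {E : Type*} [NormedAddCommGroup E] [NormedSpace ℝ E]
  {M : Type*} [TopologicalSpace M] [ChartedSpace E M]

theorem tmap_diagonal {Φ : M × M → ℝ} {x : M}
    (hΦ : MDifferentiableAt (𝓘(ℝ, E).prod 𝓘(ℝ, E)) 𝓘(ℝ, ℝ) Φ (x, x)) (v : E) :
    (tmap (fun y => Φ (y, y)) x : E →L[ℝ] ℝ) v
      = (tmap (fun y => Φ (y, x)) x : E →L[ℝ] ℝ) v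
        + (tmap (fun y => Φ (x, y)) x : E →L[ℝ] ℝ) v := by
  have h1 : HasMFDerivAt 𝓘(ℝ, E) (𝓘(ℝ, E).prod 𝓘(ℝ, E)) (fun y : M => (y, y)) x _ :=
    (hasMFDerivAt_id x).prodMk (hasMFDerivAt_id x)
  have h2 := (HasMFDerivAt.comp (f := fun y : M => (y, y)) x hΦ.hasMFDerivAt h1).mfderiv
  have h3 := mfderiv_prod_eq_add_apply (v := (v, v)) hΦ
  have h4 := congrArg (fun l : E →L[ℝ] ℝ => l v) h2
  exact h4.trans h3

end Diagonal

/-! ### Left-invariant derivatives, conjugation and the Lie bracket. -/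

section LieGroup

variable {E : Type*} [NormedAddCommGroup E] [NormedSpace ℝ E]
  {G : Type*} [TopologicalSpace G] [ChartedSpace E G] [Group G]

/-- The tangent map of the left translation by `g` at the identity. The left-invariant vector field
of `u` is `g ↦ ltr g u`. -/
def ltr (g : G) : E →L[ℝ] E := tmap (fun h : G => g * h) 1

/-- The tangent map of the conjugation by `a` at the identity. -/
def conjDeriv (a : G) : E →L[ℝ] E := tmap (fun x : G => a * x * a⁻¹) 1

theorem ltr_one : (ltr (1 : G) : E →L[ℝ] E) = ContinuousLinearMap.id ℝ E := by
  have : (fun h : G => 1 * h) = id := by ext; simp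
  rw [ltr, this, tmap_id]

variable [LieGroup 𝓘(ℝ, E) ∞ G]

theorem contMDiff_mul' : ContMDiff (𝓘(ℝ, E).prod 𝓘(ℝ, E)) 𝓘(ℝ, E) ∞ (fun q : G × G => q.1 * q.2) :=
  contMDiff_mul 𝓘(ℝ, E) ∞

theorem contMDiff_conj (a : G) : ContMDiff 𝓘(ℝ, E) 𝓘(ℝ, E) ∞ (fun x : G => a * x * a⁻¹) :=
  (contMDiff_mul_right (a := a⁻¹)).comp (contMDiff_mul_left (a := a))

variable {E' : Type*} [NormedAddCommGroup E'] [NormedSpace ℝ E']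
  {M' : Type*} [TopologicalSpace M'] [ChartedSpace E' M']

theorem tmap_ltr {f : G → M'} {g : G} (hf : MDifferentiableAt 𝓘(ℝ, E) 𝓘(ℝ, E') f g) :
    (tmap (fun h => f (g * h)) 1 : E →L[ℝ] E') = (tmap f g : E →L[ℝ] E').comp (ltr g) := by
  have h1 : MDifferentiableAt 𝓘(ℝ, E) 𝓘(ℝ, E) (fun h : G => g * h) 1 :=
    (contMDiff_mul_left (n := ∞)).mdifferentiableAt (by simp)
  have := tmap_comp (f := f) (φ := fun h : G => g * h) (1 : G) (by simpa using hf) h1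
  rw [mul_one] at this
  exact this

/-- The derivative is the partial differential of `(g, h) ↦ f (g * h)` at `h = 1`, so it is smooth
in the parameter `g`. -/
theorem contMDiffAt_tmap_ltr {f : G → ℝ} {g : G} (hf : ContMDiffAt 𝓘(ℝ, E) 𝓘(ℝ, ℝ) ∞ f g) (u : E) :
    ContMDiffAt 𝓘(ℝ, E) 𝓘(ℝ, ℝ) ∞ (fun g => (tmap f g : E →L[ℝ] ℝ) (ltr g u)) g := by
  have : IsManifold 𝓘(ℝ, E) 1 G := .of_le (n := ∞) (by simp)
  have h1 : ContMDiffAt (𝓘(ℝ, E).prod 𝓘(ℝ, E)) 𝓘(ℝ, ℝ) ∞ (fun q : G × G => f (q.1 * q.2)) (g, 1) :=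
    ContMDiffAt.comp (g := f) _ (by simpa using hf) contMDiff_mul'.contMDiffAt
  refine (contMDiffAt_tmap_partial h1 u).congr_of_eventuallyEq ?_
  have h2 := (contMDiffAt_iff_contMDiffAt_nhds (by simp)).1 (hf.of_le (m := 1) (by simp))
  filter_upwards [h2] with x hx
  rw [tmap_ltr (hx.mdifferentiableAt (by simp)), ContinuousLinearMap.comp_apply]

theorem contMDiff_tmap_ltr {f : G → ℝ} (hf : ContMDiff 𝓘(ℝ, E) 𝓘(ℝ, ℝ) ∞ f) (u : E) :
    ContMDiff 𝓘(ℝ, E) 𝓘(ℝ, ℝ) ∞ (fun g => (tmap f g : E →L[ℝ] ℝ) (ltr g u)) :=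
  fun g => contMDiffAt_tmap_ltr (hf g) u

theorem mdifferentiableAt_ltr [CompleteSpace E] (u : E) (g : G) :
    MDifferentiableAt 𝓘(ℝ, E) 𝓘(ℝ, E).tangent
      (fun y : G => (⟨y, (ltr y u : E)⟩ : TangentBundle 𝓘(ℝ, E) G)) g :=
  mdifferentiableAt_mulInvariantVectorField (I := 𝓘(ℝ, E)) (G := G) u

/-- The bracket of the Lie algebra as an operation on the model space. -/
def modelBracket (G : Type*) [TopologicalSpace G] [ChartedSpace E G] [Group G] (u v : E) : E :=
  Bracket.bracket (L := GroupLieAlgebra 𝓘(ℝ, E) G) (M := GroupLieAlgebra 𝓘(ℝ, E) G) u v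

theorem tmap_ltr_modelBracket [CompleteSpace E] {f : G → ℝ} (hf : ContMDiff 𝓘(ℝ, E) 𝓘(ℝ, ℝ) ∞ f)
    (u v : E) (g : G) :
    (tmap f g : E →L[ℝ] ℝ) (ltr g (modelBracket G u v))
      = (tmap (fun y => (tmap f y : E →L[ℝ] ℝ) (ltr y v)) g : E →L[ℝ] ℝ) (ltr g u)
        - (tmap (fun y => (tmap f y : E →L[ℝ] ℝ) (ltr y u)) g : E →L[ℝ] ℝ) (ltr g v) := by
  rw [← tmap_mlieBracket (V := fun y => ltr y u) (W := fun y => ltr y v)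
    (mdifferentiableAt_ltr u g) (mdifferentiableAt_ltr v g) hf
    ((contMDiff_tmap_ltr hf u).mdifferentiableAt (by simp))
    ((contMDiff_tmap_ltr hf v).mdifferentiableAt (by simp))]
  exact congrArg (fun w : E => (tmap f g : E →L[ℝ] ℝ) w)
    (congrFun (mulInvariantVector_mlieBracket (I := 𝓘(ℝ, E)) (G := G) u v) g)

/-- Since `a(gh)a⁻¹ = (aga⁻¹)(aha⁻¹)`, conjugation by `a` carries the left-invariant field of `u` to
that of `Ad_a u`. -/
theorem tmap_conj {f : G → M'} (a g : G)
    (hf : MDifferentiableAt 𝓘(ℝ, E) 𝓘(ℝ, E') f (a * g * a⁻¹)) (u : E) :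
    (tmap (fun x => f (a * x * a⁻¹)) g : E →L[ℝ] E') (ltr g u)
      = (tmap f (a * g * a⁻¹) : E →L[ℝ] E') (ltr (a * g * a⁻¹) (conjDeriv a u)) := by
  have hc : ∀ x : G, MDifferentiableAt 𝓘(ℝ, E) 𝓘(ℝ, E) (fun x : G => a * x * a⁻¹) x :=
    fun x => (contMDiff_conj a).mdifferentiableAt (by simp)
  have hfc : MDifferentiableAt 𝓘(ℝ, E) 𝓘(ℝ, E') (fun x => f (a * x * a⁻¹)) g := hf.comp g (hc g)
  rw [← ContinuousLinearMap.comp_apply, ← tmap_ltr hfc]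
  have e : (fun h => f (a * (g * h) * a⁻¹))
      = (fun y => f (a * g * a⁻¹ * y)) ∘ fun h : G => a * h * a⁻¹ := by
    ext h; simp [mul_assoc]
  have h1 : MDifferentiableAt 𝓘(ℝ, E) 𝓘(ℝ, E') (fun y => f (a * g * a⁻¹ * y)) (a * 1 * a⁻¹) := by
    refine MDifferentiableAt.comp (g := f) _ (by simpa using hf) ?_
    exact (contMDiff_mul_left (n := ∞)).mdifferentiableAt (by simp)
  rw [e, tmap_comp (φ := fun h : G => a * h * a⁻¹) _ h1 (hc 1)]
  have e1 : a * 1 * a⁻¹ = 1 := by simp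
  rw [e1, tmap_ltr hf]
  rfl

/-- Fields related by conjugation have related commutators; functions with arbitrary differential at
`1` detect the equality. -/
theorem conjDeriv_modelBracket [FiniteDimensional ℝ E] [T2Space G] (a : G) (u v : E) :
    conjDeriv a (modelBracket G u v) = modelBracket G (conjDeriv a u) (conjDeriv a v) := by
  have := FiniteDimensional.complete ℝ E
  refine (SeparatingDual.eq_iff_forall_dual_eq (R := ℝ)).2 fun l => ?_
  obtain ⟨f, hf, hfl⟩ := exists_contMDiff_tmap_eq (M := G) 1 l
  have hfc : ContMDiff 𝓘(ℝ, E) 𝓘(ℝ, ℝ) ∞ (fun x => f (a * x * a⁻¹)) := hf.comp (contMDiff_conj a)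
  have e1 : a * 1 * a⁻¹ = 1 := by simp
  have h1 := tmap_conj a 1 (hf.mdifferentiableAt (by simp)) (modelBracket G u v)
  rw [e1, tmap_ltr_modelBracket hfc] at h1
  have h2 : ∀ w y, (tmap (fun x => f (a * x * a⁻¹)) y : E →L[ℝ] ℝ) (ltr y w)
      = (tmap f (a * y * a⁻¹) : E →L[ℝ] ℝ) (ltr (a * y * a⁻¹) (conjDeriv a w)) :=
    fun w y => tmap_conj a y (hf.mdifferentiableAt (by simp)) w
  simp only [h2] at h1
  rw [tmap_conj (f := fun y => (tmap f y : E →L[ℝ] ℝ) (ltr y (conjDeriv a v))) a 1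
      ((contMDiff_tmap_ltr hf _).mdifferentiableAt (by simp)),
    tmap_conj (f := fun y => (tmap f y : E →L[ℝ] ℝ) (ltr y (conjDeriv a u))) a 1
      ((contMDiff_tmap_ltr hf _).mdifferentiableAt (by simp)), e1,
    ← tmap_ltr_modelBracket hf] at h1
  rw [ltr_one, hfl] at h1
  exact h1.symm

/-- The derivative of the adjoint action at the identity is the bracket. -/
theorem tmap_conjDeriv [CompleteSpace E] {f : G → ℝ} (hf : ContMDiff 𝓘(ℝ, E) 𝓘(ℝ, ℝ) ∞ f)
    (u v : E) :
    ContMDiff 𝓘(ℝ, E) 𝓘(ℝ, ℝ) ∞ (fun g : G => (tmap f 1 : E →L[ℝ] ℝ) (conjDeriv g v)) ∧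
    (tmap (fun g : G => (tmap f 1 : E →L[ℝ] ℝ) (conjDeriv g v)) 1 : E →L[ℝ] ℝ) u
      = (tmap f 1 : E →L[ℝ] ℝ) (modelBracket G u v) := by
  have hF : ContMDiff (𝓘(ℝ, E).prod 𝓘(ℝ, E)) 𝓘(ℝ, ℝ) ∞
      (fun q : G × G => f (q.1 * q.2 * q.1⁻¹)) :=
    hf.comp ((contMDiff_fst.mul contMDiff_snd).mul contMDiff_fst.inv)
  have hm : ContMDiff (𝓘(ℝ, E).prod 𝓘(ℝ, E)) 𝓘(ℝ, ℝ) ∞ (fun q : G × G => f (q.1 * q.2)) :=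
    hf.comp contMDiff_mul'
  have hfd : ∀ y, MDifferentiableAt 𝓘(ℝ, E) 𝓘(ℝ, ℝ) f y := fun y => hf.mdifferentiableAt (by simp)
  have e0 : (fun g : G => (tmap f 1 : E →L[ℝ] ℝ) (conjDeriv g v))
      = fun g => (tmap (fun h => f (g * h * g⁻¹)) 1 : E →L[ℝ] ℝ) v := by
    ext g
    have := tmap_conj g 1 (hfd _) v
    simpa [ltr_one] using this.symm
  -- The map `(q₁, q₂) ↦ f (h * q₁ * q₂⁻¹)` is constant on the diagonal, so its two partial
  -- derivatives are opposite.
  have hinv : ∀ h : G, (tmap (fun g => f (h * g⁻¹)) 1 : E →L[ℝ] ℝ) u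
      = - (tmap (fun g => f (h * g)) 1 : E →L[ℝ] ℝ) u := fun h => by
    have hΦ : ContMDiff (𝓘(ℝ, E).prod 𝓘(ℝ, E)) 𝓘(ℝ, ℝ) ∞
        (fun q : G × G => f (h * q.1 * q.2⁻¹)) :=
      hf.comp ((contMDiff_const.mul contMDiff_fst).mul contMDiff_snd.inv)
    have := tmap_diagonal (x := (1 : G)) (hΦ.mdifferentiableAt (by simp)) u
    simp only [mul_assoc, mul_inv_cancel, mul_one, inv_one, tmap_const] at this
    simp only [zero_apply] at this
    linarith
  have hdiag : ∀ h : G, (tmap (fun g => f (g * h * g⁻¹)) 1 : E →L[ℝ] ℝ) u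
      = (tmap (fun g => f (g * h)) 1 : E →L[ℝ] ℝ) u
        - (tmap f h : E →L[ℝ] ℝ) (ltr h u) := fun h => by
    have hΦ : ContMDiff (𝓘(ℝ, E).prod 𝓘(ℝ, E)) 𝓘(ℝ, ℝ) ∞
        (fun q : G × G => f (q.1 * h * q.2⁻¹)) :=
      hf.comp ((contMDiff_fst.mul contMDiff_const).mul contMDiff_snd.inv)
    have := tmap_diagonal (x := (1 : G)) (hΦ.mdifferentiableAt (by simp)) u
    simp only [inv_one, mul_one, one_mul] at this
    rw [this, hinv, tmap_ltr (hfd h), ContinuousLinearMap.comp_apply, sub_eq_add_neg]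
  refine ⟨?_, ?_⟩
  · rw [e0]
    exact fun g => contMDiffAt_tmap_partial (hF (g, 1)) v
  -- After exchanging the mixed partials, the inner `g`-derivative is the right-invariant minus the
  -- left-invariant derivative along `u`. A second exchange turns the right-invariant term into `X_u
  -- X_v f`, leaving `X_u X_v f - X_v X_u f` at `1`.
  · rw [e0, tmap_partial_comm (hF (1, 1)) u v]
    simp only [hdiag]
    have hY : ContMDiffAt 𝓘(ℝ, E) 𝓘(ℝ, ℝ) ∞
        (fun h : G => (tmap (fun g => f (g * h)) 1 : E →L[ℝ] ℝ) u) 1 :=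
      contMDiffAt_tmap_partial (F := fun q : G × G => f (q.2 * q.1))
        (ContMDiff.contMDiffAt (hf.comp (contMDiff_snd.mul contMDiff_fst))) u
    have hX := contMDiff_tmap_ltr hf u
    have hsub : (tmap (fun h : G => (tmap (fun g => f (g * h)) 1 : E →L[ℝ] ℝ) u
          - (tmap f h : E →L[ℝ] ℝ) (ltr h u)) 1 : E →L[ℝ] ℝ)
        = tmap (fun h : G => (tmap (fun g => f (g * h)) 1 : E →L[ℝ] ℝ) u) 1
          - tmap (fun h : G => (tmap f h : E →L[ℝ] ℝ) (ltr h u)) 1 :=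
      mvfderiv_sub (hY.mdifferentiableAt (by simp)) (hX.mdifferentiableAt (by simp))
    rw [hsub, sub_apply, ← tmap_partial_comm (hm (1, 1)) u v]
    have h1 := tmap_ltr_modelBracket hf u v 1
    simp only [ltr_one, ContinuousLinearMap.id_apply] at h1
    rw [h1]
    congr 3
    ext g
    rw [tmap_ltr (hfd g), ContinuousLinearMap.comp_apply]

/-- A linear form that is constant along `Ad_{γ(t)} v` vanishes on `[γ'(0), v]`. -/
theorem apply_modelBracket_eq_zero [FiniteDimensional ℝ E] [T2Space G] {γ : ℝ → G} (h0 : γ 0 = 1)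
    (hγ : MDifferentiableAt 𝓘(ℝ, ℝ) 𝓘(ℝ, E) γ 0) (l : E →L[ℝ] ℝ) (v : E)
    (h : ∀ t, l (conjDeriv (γ t) v) = l v) :
    l (modelBracket G ((tmap γ 0 : ℝ →L[ℝ] E) 1) v) = 0 := by
  have := FiniteDimensional.complete ℝ E
  obtain ⟨f, hf, hfl⟩ := exists_contMDiff_tmap_eq (M := G) 1 l
  obtain ⟨h1, h2⟩ := tmap_conjDeriv hf ((tmap γ 0 : ℝ →L[ℝ] E) 1) v
  rw [hfl] at h1 h2
  rw [← h2]
  have h3 := tmap_comp (f := fun g : G => l (conjDeriv g v)) (0 : ℝ)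
    (h1.mdifferentiableAt (I' := 𝓘(ℝ, ℝ)) (by simp)) hγ
  have h4 : (fun g : G => l (conjDeriv g v)) ∘ γ = fun _ => l v := funext h
  rw [h4, tmap_const, h0] at h3
  exact (congrArg (fun k : ℝ →L[ℝ] ℝ => k 1) h3).symm

end LieGroup

/-! ### Completeness of left-invariant fields. -/

section IntegralCurves

variable {E : Type*} [NormedAddCommGroup E] [NormedSpace ℝ E]
  {G : Type*} [TopologicalSpace G] [ChartedSpace E G] [Group G] [LieGroup 𝓘(ℝ, E) ∞ G]

theorem tmap_mul_left_ltr (g y : G) :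
    (tmap (fun h : G => g * h) y : E →L[ℝ] E).comp (ltr y) = ltr (g * y) := by
  rw [← tmap_ltr ((contMDiff_mul_left (n := ∞)).mdifferentiableAt (by simp)), ltr]
  simp only [mul_assoc]

/-- The left-invariant vector field of `u`. -/
def linvField (G : Type*) [TopologicalSpace G] [ChartedSpace E G] [Group G] (u : E) :
    Π g : G, TangentSpace 𝓘(ℝ, E) g :=
  fun g => (ltr g u : E)

/-- Left-invariant vector fields are complete. -/
theorem exists_isMIntegralCurve_linvField [CompleteSpace E] [T2Space G] (u : E) :
    ∃ γ : ℝ → G, γ 0 = 1 ∧ IsMIntegralCurve (I := 𝓘(ℝ, E)) γ (linvField G u) := by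
  have : IsManifold 𝓘(ℝ, E) 1 G := .of_le (n := ∞) (by simp)
  have hv : ContMDiff 𝓘(ℝ, E) 𝓘(ℝ, E).tangent 1
      (fun g : G => (⟨g, linvField G u g⟩ : TangentBundle 𝓘(ℝ, E) G)) := by
    refine (contMDiff_mulInvariantVectorField (I := 𝓘(ℝ, E)) (G := G) u).of_le ?_
    rw [minSmoothness_of_isRCLikeNormedField]
    norm_num
  obtain ⟨γ, hγ0, hγ⟩ := exists_isMIntegralCurveAt_of_contMDiffAt_boundaryless (t₀ := 0)
    (hv.contMDiffAt (x := 1))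
  rw [isMIntegralCurveAt_iff'] at hγ
  obtain ⟨ε, hε, hγ⟩ := hγ
  -- Left translates of the curve through `1` are integral curves, so the same `ε` serves at every
  -- point.
  refine exists_isMIntegralCurve_of_isMIntegralCurveOn hv hε (fun g => ?_) 1
  refine ⟨fun t => g * γ t, by simp [hγ0], ?_⟩
  intro t ht
  have h1 := hγ t (by simpa [Real.ball_eq_Ioo] using ht)
  have h2 : MDifferentiableAt 𝓘(ℝ, E) 𝓘(ℝ, E) (fun h : G => g * h) (γ t) :=
    (contMDiff_mul_left (n := ∞)).mdifferentiableAt (by simp)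
  rw [Real.ball_eq_Ioo, zero_sub, zero_add] at h1
  have h3 := h2.hasMFDerivAt.comp_hasMFDerivWithinAt t h1
  have h4 : ∀ w : E, (tmap (fun h : G => g * h) (γ t) : E →L[ℝ] E) (ltr (γ t) w)
      = ltr (g * γ t) w := fun w => congrArg (fun l : E →L[ℝ] E => l w) (tmap_mul_left_ltr g (γ t))
  have h5 : (tmap (fun h : G => g * h) (γ t) : E →L[ℝ] E).comp
      ((1 : ℝ →L[ℝ] ℝ).smulRight (ltr (γ t) u : E))
      = (1 : ℝ →L[ℝ] ℝ).smulRight (ltr (g * γ t) u : E) := by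
    ext
    simp [h4]
  exact h5 ▸ h3

theorem IsMIntegralCurve.tmap_one {M : Type*} [TopologicalSpace M] [ChartedSpace E M]
    {γ : ℝ → M} {V : Π x : M, TangentSpace 𝓘(ℝ, E) x}
    (h : IsMIntegralCurve (I := 𝓘(ℝ, E)) γ V) (t : ℝ) :
    MDifferentiableAt 𝓘(ℝ, ℝ) 𝓘(ℝ, E) γ t ∧ (tmap γ t : ℝ →L[ℝ] E) 1 = V (γ t) := by
  refine ⟨(h t).mdifferentiableAt, ?_⟩
  have h1 := (h t).mfderiv
  have h2 := congrArg (fun l : ℝ →L[ℝ] E => l 1) h1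
  refine h2.trans ?_
  exact one_smul ℝ (V (γ t) : E)

theorem IsMIntegralCurve.tmap_ltr {G : Type*} [TopologicalSpace G] [ChartedSpace E G] [Group G]
    {γ : ℝ → G} {u : E}
    (h : IsMIntegralCurve (I := 𝓘(ℝ, E)) γ (linvField G u)) (t : ℝ) :
    (tmap γ t : ℝ →L[ℝ] E) 1 = ltr (γ t) u :=
  (h.tmap_one t).2

end IntegralCurves

/-! ### The projection onto `G/H`, its equivariance and its kernel. -/

section Homogeneous

variable {E : Type*} [NormedAddCommGroup E] [NormedSpace ℝ E]
  {G : Type*} [TopologicalSpace G] [ChartedSpace E G] [Group G]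
  {H : Subgroup G}
  {F : Type*} [NormedAddCommGroup F] [NormedSpace ℝ F]
  [ChartedSpace F (G ⧸ H)]

/-- The tangent map of the projection `G → G ⧸ H` at the identity. -/
def tproj (H : Subgroup G) [ChartedSpace F (G ⧸ H)] : E →L[ℝ] F :=
  tmap (fun g : G => (g : G ⧸ H)) 1

theorem tproj_eq_zero_of_curve_mem
    (hp : Manifold.IsSubmersion 𝓘(ℝ, E) 𝓘(ℝ, F) ∞ (fun g : G => (g : G ⧸ H)))
    {u : E} {γ : ℝ → G} (h0 : γ 0 = 1) (hγ : IsMIntegralCurve (I := 𝓘(ℝ, E)) γ (linvField G u))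
    (hmem : ∀ t, γ t ∈ H) : (tproj H : E →L[ℝ] F) u = 0 := by
  have hd : ∀ x, MDifferentiableAt 𝓘(ℝ, E) 𝓘(ℝ, F) (fun g : G => (g : G ⧸ H)) x :=
    fun x => hp.contMDiff.mdifferentiableAt (by simp)
  have h1 := tmap_comp (f := fun g : G => (g : G ⧸ H)) (0 : ℝ) (hd _) (hγ.tmap_one 0).1
  have h2 : (fun g : G => (g : G ⧸ H)) ∘ γ = fun _ => ((1 : G) : G ⧸ H) := by
    ext t
    exact (QuotientGroup.eq.2 (by simpa using hmem t)).symm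
  have h3 := congrArg (fun l : ℝ →L[ℝ] F => l 1) h1
  rw [h2, tmap_const] at h3
  simp only [ContinuousLinearMap.comp_apply, hγ.tmap_ltr, h0, ltr_one] at h3
  exact h3.symm

variable [LieGroup 𝓘(ℝ, E) ∞ G]

/-- The tangent map of the translation `x ↦ g x` of `G ⧸ H`. -/
def tsmul (g : G) (x : G ⧸ H) : F →L[ℝ] F := tmap (fun y : G ⧸ H => g • y) x

theorem contMDiff_smul_quotient
    (hp : Manifold.IsSubmersion 𝓘(ℝ, E) 𝓘(ℝ, F) ∞ (fun g : G => (g : G ⧸ H))) (g : G) :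
    ContMDiff 𝓘(ℝ, F) 𝓘(ℝ, F) ∞ (fun y : G ⧸ H => g • y) := by
  intro x
  obtain ⟨a, rfl⟩ := QuotientGroup.mk_surjective x
  refine hp.contMDiffAt_of_comp (x := a) ?_
  exact (hp.contMDiff.comp (contMDiff_mul_left (a := g))).contMDiffAt

/-- The differential at `1` of `p(gh) = g • p(h)`. -/
theorem tmap_mk_ltr
    (hp : Manifold.IsSubmersion 𝓘(ℝ, E) 𝓘(ℝ, F) ∞ (fun g : G => (g : G ⧸ H))) (g : G) :
    (tmap (fun g : G => (g : G ⧸ H)) g : E →L[ℝ] F).comp (ltr g)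
      = (tsmul g ((1 : G) : G ⧸ H) : F →L[ℝ] F).comp (tproj H) := by
  have hd : ∀ x, MDifferentiableAt 𝓘(ℝ, E) 𝓘(ℝ, F) (fun g : G => (g : G ⧸ H)) x :=
    fun x => hp.contMDiff.mdifferentiableAt (by simp)
  rw [← tmap_ltr (hd g), tproj, tsmul, ← tmap_comp (1 : G)
    ((contMDiff_smul_quotient hp g).mdifferentiableAt (by simp)) (hd 1)]
  rfl

theorem tsmul_mul (hp : Manifold.IsSubmersion 𝓘(ℝ, E) 𝓘(ℝ, F) ∞ (fun g : G => (g : G ⧸ H)))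
    (g g' : G) (x : G ⧸ H) :
    (tsmul (g * g') x : F →L[ℝ] F) = (tsmul g (g' • x)).comp (tsmul g' x) := by
  have h : ∀ (a : G) (y : G ⧸ H), MDifferentiableAt 𝓘(ℝ, F) 𝓘(ℝ, F) (fun y : G ⧸ H => a • y) y :=
    fun a y => (contMDiff_smul_quotient hp a).mdifferentiableAt (by simp)
  rw [tsmul, tsmul, tsmul, ← tmap_comp x (h _ _) (h _ _)]
  congr 1
  ext y
  simp [mul_smul]

theorem tsmul_one (x : G ⧸ H) :
    (tsmul (1 : G) x : F →L[ℝ] F) = ContinuousLinearMap.id ℝ F := by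
  have : (fun y : G ⧸ H => (1 : G) • y) = id := by ext; simp
  rw [tsmul, this, tmap_id]

/-- For `a ∈ H` one has `p(axa⁻¹) = p(ax) = a • p(x)`. Thus `Ad_a` induces the isotropy action on
the tangent space at the base point. -/
theorem tproj_conjDeriv
    (hp : Manifold.IsSubmersion 𝓘(ℝ, E) 𝓘(ℝ, F) ∞ (fun g : G => (g : G ⧸ H))) {a : G} (ha : a ∈ H)
    (u : E) :
    (tproj H : E →L[ℝ] F) (conjDeriv a u)
      = (tsmul a ((1 : G) : G ⧸ H) : F →L[ℝ] F) (tproj H u) := by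
  have hd : ∀ x, MDifferentiableAt 𝓘(ℝ, E) 𝓘(ℝ, F) (fun g : G => (g : G ⧸ H)) x :=
    fun x => hp.contMDiff.mdifferentiableAt (by simp)
  have h1 := tmap_conj a 1 (hd _) u
  have e1 : a * 1 * a⁻¹ = 1 := by simp
  rw [e1] at h1
  simp only [ltr_one, ContinuousLinearMap.id_apply] at h1
  have e2 : (fun x : G => ((a * x * a⁻¹ : G) : G ⧸ H)) = fun x : G => ((a * x : G) : G ⧸ H) := by
    ext x
    exact QuotientGroup.mk_mul_of_mem _ (H.inv_mem ha)
  rw [e2, tmap_ltr (hd a), tmap_mk_ltr hp] at h1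
  exact h1.symm

/-- The velocity of `p ∘ γ` is a translate of `T_e p u = 0`. By uniqueness of integral curves of the
zero field, `p ∘ γ` is constant. -/
theorem exists_curve_mem_of_tproj_eq_zero [FiniteDimensional ℝ E] [T2Space G] [T2Space (G ⧸ H)]
    [IsManifold 𝓘(ℝ, F) ∞ (G ⧸ H)]
    (hp : Manifold.IsSubmersion 𝓘(ℝ, E) 𝓘(ℝ, F) ∞ (fun g : G => (g : G ⧸ H)))
    {u : E} (hu : (tproj H : E →L[ℝ] F) u = 0) :
    ∃ γ : ℝ → G, γ 0 = 1 ∧ IsMIntegralCurve (I := 𝓘(ℝ, E)) γ (linvField G u) ∧ ∀ t, γ t ∈ H := by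
  have := FiniteDimensional.complete ℝ E
  have hd : ∀ x, MDifferentiableAt 𝓘(ℝ, E) 𝓘(ℝ, F) (fun g : G => (g : G ⧸ H)) x :=
    fun x => hp.contMDiff.mdifferentiableAt (by simp)
  obtain ⟨γ, h0, hγ⟩ := exists_isMIntegralCurve_linvField (G := G) u
  refine ⟨γ, h0, hγ, fun t => ?_⟩
  have : IsManifold 𝓘(ℝ, F) 1 (G ⧸ H) := .of_le (n := ∞) (by simp)
  have h1 : IsMIntegralCurve (I := 𝓘(ℝ, F)) (fun t => (γ t : G ⧸ H)) (fun _ => 0) := by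
    intro t
    have h2 := (hd (γ t)).hasMFDerivAt.comp t (hγ t)
    have h3 : (tmap (fun g : G => (g : G ⧸ H)) (γ t) : E →L[ℝ] F).comp
        ((1 : ℝ →L[ℝ] ℝ).smulRight (ltr (γ t) u : E)) = (1 : ℝ →L[ℝ] ℝ).smulRight (0 : F) := by
      ext
      have := congrArg (fun l : E →L[ℝ] F => l u) (tmap_mk_ltr hp (γ t))
      simp only [ContinuousLinearMap.comp_apply, hu, map_zero] at this
      simp [this]
    exact h3 ▸ h2
  have h2 : IsMIntegralCurve (I := 𝓘(ℝ, F)) (fun _ : ℝ => ((1 : G) : G ⧸ H)) (fun _ => 0) := by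
    intro t
    have h3 := hasMFDerivAt_const (I := 𝓘(ℝ, ℝ)) (I' := 𝓘(ℝ, F)) ((1 : G) : G ⧸ H) t
    have h4 : (1 : ℝ →L[ℝ] ℝ).smulRight (0 : F) = 0 := by ext; simp
    exact h4 ▸ h3
  have h3 := isMIntegralCurve_Ioo_eq_of_contMDiff_boundaryless (t₀ := 0)
    (Bundle.contMDiff_zeroSection ℝ (TangentSpace 𝓘(ℝ, F) : G ⧸ H → Type _)) h1 h2 (by simp [h0])
  have h4 := congrFun h3 t
  simpa using QuotientGroup.eq.1 h4.symm

/-- The vectors whose one-parameter curves stay in `H` are exactly the kernel, so taking their span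
adds nothing. -/
theorem tangentProj_eq_zero_iff [FiniteDimensional ℝ E] [T2Space G] [T2Space (G ⧸ H)]
    [IsManifold 𝓘(ℝ, F) ∞ (G ⧸ H)]
    (hp : Manifold.IsSubmersion 𝓘(ℝ, E) 𝓘(ℝ, F) ∞ (fun g : G => (g : G ⧸ H)))
    (u : GroupLieAlgebra 𝓘(ℝ, E) G) :
    tangentProj (F := F) H u = 0 ↔ u ∈ subgroupLieAlgebra H := by
  constructor
  · exact fun hu => Submodule.subset_span (exists_curve_mem_of_tproj_eq_zero hp hu)
  · have hle : subgroupLieAlgebra H ≤ LinearMap.ker (tangentProj (E := E) (F := F) H) := by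
      refine Submodule.span_le.2 ?_
      rintro w ⟨γ, h0, hγ, hmem⟩
      exact tproj_eq_zero_of_curve_mem hp h0 hγ hmem
    exact fun hu => hle hu

end Homogeneous

/-! ### Functoriality and skew symmetry of bivectors. -/

namespace Bivector

variable {V W U : Type*} [AddCommGroup V] [Module ℝ V] [AddCommGroup W] [Module ℝ W]
  [AddCommGroup U] [Module ℝ U]

theorem map_comp (ψ : W →ₗ[ℝ] U) (φ : V →ₗ[ℝ] W) (r : Bivector V) :
    map (ψ ∘ₗ φ) r = map ψ (map φ r) := rfl

theorem map_id (r : Bivector V) : map LinearMap.id r = r := rfl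

theorem map_injective {φ : V →ₗ[ℝ] W} {ψ : W →ₗ[ℝ] V} (h : ψ ∘ₗ φ = LinearMap.id) :
    Function.Injective (map φ) := fun r s hrs => by
  have := congrArg (map ψ) hrs
  rwa [← map_comp, ← map_comp, h, map_id, map_id] at this

theorem apply_swap (r : Bivector V) (α β : Module.Dual ℝ V) : r.1 α β = -r.1 β α := by
  have h := r.2 (α + β)
  have h1 := r.2 α
  have h2 := r.2 β
  simp only [map_add, LinearMap.add_apply] at h
  linarith

end Bivector

/-! ### Algebra of a reductive pair: Yang–Baxter equation and Lie brackets on invariants. -/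

namespace ReductiveDecomposition

variable {E : Type*} [NormedAddCommGroup E] [NormedSpace ℝ E]
  {G : Type*} [TopologicalSpace G] [ChartedSpace E G] [Group G]
  {H : Subgroup G} (D : ReductiveDecomposition E H)

theorem proj_coe (u : D.𝔪) : D.proj (u : GroupLieAlgebra 𝓘(ℝ, E) G) = u :=
  Submodule.projectionOnto_apply_left _ u

theorem proj_eq_zero_iff {w : GroupLieAlgebra 𝓘(ℝ, E) G} :
    D.proj w = 0 ↔ w ∈ subgroupLieAlgebra H :=
  Submodule.projectionOnto_apply_eq_zero_iff _

theorem sub_proj_mem (w : GroupLieAlgebra 𝓘(ℝ, E) G) :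
    w - (D.proj w : GroupLieAlgebra 𝓘(ℝ, E) G) ∈ subgroupLieAlgebra H := by
  rw [← D.proj_eq_zero_iff, map_sub, D.proj_coe, sub_self]

theorem proj_lieAd {a : H}
    (hH : ∀ w ∈ subgroupLieAlgebra (E := E) H, lieAd (a : G) w ∈ subgroupLieAlgebra H)
    (w : GroupLieAlgebra 𝓘(ℝ, E) G) : D.proj (lieAd (a : G) w) = D.adM a (D.proj w) := by
  have h1 : lieAd (a : G) w
      = (D.adM a (D.proj w) : GroupLieAlgebra 𝓘(ℝ, E) G)
        + lieAd (a : G) (w - (D.proj w : GroupLieAlgebra 𝓘(ℝ, E) G)) := by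
    rw [map_sub]
    exact (add_sub_cancel _ _).symm
  rw [h1, map_add, D.proj_coe, D.proj_eq_zero_iff.2 (hH _ (D.sub_proj_mem w)), add_zero]

variable [FiniteDimensional ℝ E]

/-- Invariance of `r` makes `r_#` equivariant under `H`; this is checked against all covectors `β`.
-/
theorem sharp_mem_invariants {r : Bivector D.𝔪} (hr : r ∈ D.bivectorInvariants)
    {α : Module.Dual ℝ D.𝔪} (hα : α ∈ D.dualInvariants) :
    Bivector.sharp r α ∈ D.invariants := fun a => by
  refine (Module.forall_dual_apply_eq_zero_iff ℝ (D.adM a (Bivector.sharp r α) -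
    Bivector.sharp r α)).1 (fun β => ?_) |> sub_eq_zero.1
  rw [map_sub, Bivector.dual_sharp]
  have h1 : β (D.adM a (Bivector.sharp r α)) = r.1 α ((D.adM a).dualMap β) :=
    Bivector.dual_sharp r α ((D.adM a).dualMap β)
  have h2 : r.1 ((D.adM a).dualMap α) ((D.adM a).dualMap β) = r.1 α β :=
    congrArg (fun s : Bivector D.𝔪 => s.1 α β) (hr a)
  rw [h1, ← h2, hα a, sub_self]

variable [LieGroup 𝓘(ℝ, E) ∞ G]

theorem bracketM_apply [CompleteSpace E] (u v : D.𝔪) :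
    D.bracketM u v
      = D.proj ⁅(u : GroupLieAlgebra 𝓘(ℝ, E) G), (v : GroupLieAlgebra 𝓘(ℝ, E) G)⁆ := rfl

theorem dualBracket_apply [CompleteSpace E] (r : Bivector D.𝔪) (α β : Module.Dual ℝ D.𝔪)
    (v : D.𝔪) :
    D.dualBracket r α β v
      = -β (D.bracketM (Bivector.sharp r α) v) + α (D.bracketM (Bivector.sharp r β) v) := rfl

theorem bracketM_swap (u v : D.𝔪) : D.bracketM u v = -D.bracketM v u := by
  have := FiniteDimensional.complete ℝ E
  rw [bracketM_apply, bracketM_apply, ← lie_skew, map_neg]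

/-- The classical Yang–Baxter equation in cyclic form. -/
theorem isYangBaxter_iff (r : Bivector D.𝔪) :
    D.IsYangBaxter r ↔ ∀ α β γ : Module.Dual ℝ D.𝔪,
      γ (D.bracketM (Bivector.sharp r α) (Bivector.sharp r β))
        + β (D.bracketM (Bivector.sharp r γ) (Bivector.sharp r α))
        + α (D.bracketM (Bivector.sharp r β) (Bivector.sharp r γ)) = 0 := by
  have := FiniteDimensional.complete ℝ E
  -- Skew symmetry of `r` turns the pairing with `γ` into minus the evaluation of `[α, β]_r` at
  -- `γ^#`.
  have key : ∀ α β γ : Module.Dual ℝ D.𝔪, γ (Bivector.sharp r (D.dualBracket r α β))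
      = - β (D.bracketM (Bivector.sharp r γ) (Bivector.sharp r α))
        - α (D.bracketM (Bivector.sharp r β) (Bivector.sharp r γ)) := fun α β γ => by
    rw [Bivector.dual_sharp, Bivector.apply_swap, ← Bivector.dual_sharp, dualBracket_apply,
      D.bracketM_swap (Bivector.sharp r γ), map_neg]
    ring
  constructor
  · intro h α β γ
    have := key α β γ
    rw [h α β] at this
    linarith
  · intro h α β
    refine sub_eq_zero.1 ((Module.forall_dual_apply_eq_zero_iff ℝ _).1 fun γ => ?_)
    rw [map_sub, key]
    linarith [h α β γ]

theorem adM_bracketM [CompleteSpace E]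
    (hAd : ∀ (a : H) (w : GroupLieAlgebra 𝓘(ℝ, E) G),
      D.proj (lieAd (a : G) w) = D.adM a (D.proj w))
    (hlie : ∀ (a : G) (u v : GroupLieAlgebra 𝓘(ℝ, E) G), lieAd a ⁅u, v⁆ = ⁅lieAd a u, lieAd a v⁆)
    (a : H) (u v : D.𝔪) : D.adM a (D.bracketM u v) = D.bracketM (D.adM a u) (D.adM a v) := by
  rw [bracketM_apply, ← hAd, hlie]
  rfl

/-- An invariant `u` commutes with the `𝔥`-part of `w`. This removes the inner projection from
iterated brackets, so their Jacobi identity reduces to that of `𝔤`. -/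
theorem bracketM_proj [CompleteSpace E]
    (hinv : ∀ x ∈ subgroupLieAlgebra (E := E) H, ∀ u ∈ D.invariants,
      ⁅x, (u : GroupLieAlgebra 𝓘(ℝ, E) G)⁆ = 0) {u : D.𝔪} (hu : u ∈ D.invariants)
    (w : GroupLieAlgebra 𝓘(ℝ, E) G) :
    D.bracketM u (D.proj w) = D.proj ⁅(u : GroupLieAlgebra 𝓘(ℝ, E) G), w⁆ := by
  have h := hinv _ (D.sub_proj_mem w) u hu
  rw [sub_lie, sub_eq_zero] at h
  rw [bracketM_apply, ← lie_skew, ← h, lie_skew]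

theorem isLieBracketOn_bracketM [CompleteSpace E]
    (hAd : ∀ (a : H) (w : GroupLieAlgebra 𝓘(ℝ, E) G),
      D.proj (lieAd (a : G) w) = D.adM a (D.proj w))
    (hlie : ∀ (a : G) (u v : GroupLieAlgebra 𝓘(ℝ, E) G), lieAd a ⁅u, v⁆ = ⁅lieAd a u, lieAd a v⁆)
    (hinv : ∀ x ∈ subgroupLieAlgebra (E := E) H, ∀ u ∈ D.invariants,
      ⁅x, (u : GroupLieAlgebra 𝓘(ℝ, E) G)⁆ = 0) :
    IsLieBracketOn D.bracketM D.invariants where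
  mem := fun u hu v hv a => by rw [D.adM_bracketM hAd hlie, hu a, hv a]
  self := fun u _ => by rw [bracketM_apply, lie_self, map_zero]
  jacobi := fun x hx y hy z hz => by
    rw [D.bracketM_apply y z, D.bracketM_apply z x, D.bracketM_apply x y,
      D.bracketM_proj hinv hx, D.bracketM_proj hinv hy, D.bracketM_proj hinv hz,
      ← map_add, ← map_add, lie_jacobi, map_zero]

theorem isLieBracketOn_dualBracket [CompleteSpace E]
    (hAd : ∀ (a : H) (w : GroupLieAlgebra 𝓘(ℝ, E) G),
      D.proj (lieAd (a : G) w) = D.adM a (D.proj w))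
    (hlie : ∀ (a : G) (u v : GroupLieAlgebra 𝓘(ℝ, E) G), lieAd a ⁅u, v⁆ = ⁅lieAd a u, lieAd a v⁆)
    (hinv : ∀ x ∈ subgroupLieAlgebra (E := E) H, ∀ u ∈ D.invariants,
      ⁅x, (u : GroupLieAlgebra 𝓘(ℝ, E) G)⁆ = 0)
    (hdual : ∀ x ∈ subgroupLieAlgebra (E := E) H, ∀ α ∈ D.dualInvariants, ∀ v : D.𝔪,
      α (D.proj ⁅x, (v : GroupLieAlgebra 𝓘(ℝ, E) G)⁆) = 0)
    {r : Bivector D.𝔪} (hr : r ∈ D.bivectorInvariants) (hYB : D.IsYangBaxter r) :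
    IsLieBracketOn (D.dualBracket r) D.dualInvariants where
  mem := fun α hα β hβ a => by
    ext v
    have h : ∀ γ ∈ D.dualInvariants, ∀ u ∈ D.invariants,
        γ (D.bracketM u (D.adM a v)) = γ (D.bracketM u v) := fun γ hγ u hu => by
      have h1 := D.adM_bracketM hAd hlie a u v
      rw [hu a] at h1
      rw [← h1]
      exact congrArg (fun l : Module.Dual ℝ D.𝔪 => l (D.bracketM u v)) (hγ a)
    rw [LinearMap.dualMap_apply, dualBracket_apply, dualBracket_apply,
      h β hβ _ (D.sharp_mem_invariants hr hα), h α hα _ (D.sharp_mem_invariants hr hβ)]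
  self := fun α _ => by
    ext v
    rw [dualBracket_apply]
    simp
  jacobi := by
    have key : ∀ α ∈ D.dualInvariants, ∀ β ∈ D.dualInvariants, ∀ γ ∈ D.dualInvariants,
        ∀ v : D.𝔪, D.dualBracket r α (D.dualBracket r β γ) v
          = γ (D.bracketM (Bivector.sharp r β) (D.bracketM (Bivector.sharp r α) v))
            - β (D.bracketM (Bivector.sharp r γ) (D.bracketM (Bivector.sharp r α) v))
            + α (D.bracketM (Bivector.sharp r β) (D.bracketM (Bivector.sharp r γ) v))
            - α (D.bracketM (Bivector.sharp r γ) (D.bracketM (Bivector.sharp r β) v)) := by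
      intro α hα β hβ γ hγ v
      have hb := D.sharp_mem_invariants hr hβ
      have hc := D.sharp_mem_invariants hr hγ
      set b := Bivector.sharp r β
      set c := Bivector.sharp r γ
      -- Jacobi in `𝔤`: the `𝔥`-part of `[b, c]` is invisible to the invariant covector `α`, and the
      -- inner projections drop out because `b` and `c` are invariant.
      have h1 : α (D.bracketM (D.bracketM b c) v)
          = α (D.bracketM b (D.bracketM c v)) - α (D.bracketM c (D.bracketM b v)) := by
        have h2 := hdual _ (D.sub_proj_mem
          ⁅(b : GroupLieAlgebra 𝓘(ℝ, E) G), (c : GroupLieAlgebra 𝓘(ℝ, E) G)⁆) α hα v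
        rw [sub_lie, map_sub, map_sub, sub_eq_zero, lie_lie, map_sub, map_sub] at h2
        rw [D.bracketM_apply c v, D.bracketM_apply b v, D.bracketM_proj hinv hb,
          D.bracketM_proj hinv hc, h2]
        rfl
      -- The Yang–Baxter equation replaces `[β, γ]_r^#` by `[b, c]_𝔪`; the resulting terms cancel in
      -- the cyclic sum.
      rw [dualBracket_apply, dualBracket_apply, hYB β γ, h1]
      ring
    intro α hα β hβ γ hγ
    ext v
    simp only [LinearMap.add_apply, LinearMap.zero_apply]
    rw [key α hα β hβ γ hγ, key β hβ γ hγ α hα, key γ hγ α hα β hβ]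
    ring

end ReductiveDecomposition

/-! ### Bivectors in coordinates. -/

namespace Bivector

variable {V : Type*} [AddCommGroup V] [Module ℝ V] {ι : Type*} [Fintype ι]

theorem apply_eq_sum (b : Module.Basis ι ℝ V) (r : Bivector V) (α β : Module.Dual ℝ V) :
    r.1 α β = ∑ i, ∑ j, r.1 (b.coord i) (b.coord j) * (α (b i) * β (b j)) := by
  have h : ∀ α : Module.Dual ℝ V, α = ∑ i, α (b i) • b.coord i := fun α => by
    refine b.ext fun j => ?_
    classical
    simp
  conv_lhs => rw [h α, h β]
  simp only [map_sum, map_smul, LinearMap.sum_apply, LinearMap.smul_apply, smul_eq_mul,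
    Finset.mul_sum]
  rw [Finset.sum_comm]
  refine Finset.sum_congr rfl fun i _ => Finset.sum_congr rfl fun j _ => ?_
  ring

end Bivector

/-! ### Differentiating `r(df, dk)` along left-invariant fields. -/

section Invariant

variable {E : Type*} [NormedAddCommGroup E] [NormedSpace ℝ E]
  {G : Type*} [TopologicalSpace G] [ChartedSpace E G] [Group G]
  {V : Type*} [AddCommGroup V] [Module ℝ V] (e : V →ₗ[ℝ] E)

/-- The derivatives of `f` at `g` along the left-invariant vector fields of the vectors `e w`. -/
def ldiff (f : G → ℝ) (g : G) : Module.Dual ℝ V :=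
  ((tmap f g : E →L[ℝ] ℝ).comp (ltr g)).toLinearMap ∘ₗ e

theorem ldiff_apply (f : G → ℝ) (g : G) (w : V) :
    ldiff e f g w = (tmap f g : E →L[ℝ] ℝ) (ltr g (e w)) := rfl

variable [LieGroup 𝓘(ℝ, E) ∞ G] [FiniteDimensional ℝ V]

theorem contMDiffAt_apply_ldiff (r : Bivector V) {f k : G → ℝ} {g : G}
    (hf : ContMDiffAt 𝓘(ℝ, E) 𝓘(ℝ, ℝ) ∞ f g) (hk : ContMDiffAt 𝓘(ℝ, E) 𝓘(ℝ, ℝ) ∞ k g) :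
    ContMDiffAt 𝓘(ℝ, E) 𝓘(ℝ, ℝ) ∞ (fun g => r.1 (ldiff e f g) (ldiff e k g)) g := by
  rw [funext fun g => Bivector.apply_eq_sum (Module.finBasis ℝ V) r (ldiff e f g) (ldiff e k g)]
  refine contMDiffAt_finsetSum fun i _ => contMDiffAt_finsetSum fun j _ => ?_
  exact contMDiffAt_const.mul ((contMDiffAt_tmap_ltr hf _).mul (contMDiffAt_tmap_ltr hk _))

/-- The Leibniz rule for the derivative of `r(df, dk)` along a left-invariant vector field. -/
theorem ldiff_apply_ldiff (r : Bivector V) {f k : G → ℝ}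
    (hf : ContMDiff 𝓘(ℝ, E) 𝓘(ℝ, ℝ) ∞ f) (hk : ContMDiff 𝓘(ℝ, E) 𝓘(ℝ, ℝ) ∞ k) (g : G) (a : V) :
    ldiff e (fun g => r.1 (ldiff e f g) (ldiff e k g)) g a
      = ldiff e (fun y => ldiff e k y (Bivector.sharp r (ldiff e f g))) g a
        - ldiff e (fun y => ldiff e f y (Bivector.sharp r (ldiff e k g))) g a := by
  set b := Module.finBasis ℝ V
  have hX : ∀ {f : G → ℝ}, ContMDiff 𝓘(ℝ, E) 𝓘(ℝ, ℝ) ∞ f → ∀ w : V,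
      MDifferentiableAt 𝓘(ℝ, E) 𝓘(ℝ, ℝ) (fun y => ldiff e f y w) g :=
    fun hf w => (contMDiff_tmap_ltr hf (e w)).mdifferentiableAt (by simp)
  have hlin : ∀ {f : G → ℝ}, ContMDiff 𝓘(ℝ, E) 𝓘(ℝ, ℝ) ∞ f → ∀ w : V,
      ldiff e (fun y => ldiff e f y w) g a
        = ∑ i, b.coord i w * ldiff e (fun y => ldiff e f y (b i)) g a := fun {f} hf w => by
    have h1 : (fun y => ldiff e f y w) = fun y => ∑ i, b.coord i w * ldiff e f y (b i) := by
      ext y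
      conv_lhs => rw [← b.sum_repr w]
      simp only [map_sum, map_smul, smul_eq_mul, Module.Basis.coord_apply]
    have h2 : ∀ i, MDifferentiableAt 𝓘(ℝ, E) 𝓘(ℝ, ℝ)
        (fun y => b.coord i w * ldiff e f y (b i)) g :=
      fun i => mdifferentiableAt_const.mul (hX hf _)
    rw [h1, ldiff_apply, tmap_sum _ fun i _ => h2 i, sum_apply]
    refine Finset.sum_congr rfl fun i _ => ?_
    rw [tmap_const_mul (hX hf _)]
    rfl
  have h1 : (fun g => r.1 (ldiff e f g) (ldiff e k g))
      = fun g => ∑ i, ∑ j, r.1 (b.coord i) (b.coord j) * (ldiff e f g (b i) * ldiff e k g (b j)) :=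
    funext fun g => Bivector.apply_eq_sum b r _ _
  have hm : ∀ i j, MDifferentiableAt 𝓘(ℝ, E) 𝓘(ℝ, ℝ)
      (fun y => ldiff e f y (b i) * ldiff e k y (b j)) g := fun i j => (hX hf _).mul (hX hk _)
  have hcm : ∀ i j, MDifferentiableAt 𝓘(ℝ, E) 𝓘(ℝ, ℝ)
      (fun y => r.1 (b.coord i) (b.coord j) * (ldiff e f y (b i) * ldiff e k y (b j))) g :=
    fun i j => mdifferentiableAt_const.mul (hm i j)
  have h2 : ldiff e (fun g => r.1 (ldiff e f g) (ldiff e k g)) g a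
      = ∑ i, ∑ j, r.1 (b.coord i) (b.coord j)
        * (ldiff e f g (b i) * ldiff e (fun y => ldiff e k y (b j)) g a
          + ldiff e (fun y => ldiff e f y (b i)) g a * ldiff e k g (b j)) := by
    have hs : ∀ i, MDifferentiableAt 𝓘(ℝ, E) 𝓘(ℝ, ℝ) (fun y => ∑ j, r.1 (b.coord i) (b.coord j)
        * (ldiff e f y (b i) * ldiff e k y (b j))) g := fun i => by
      have : ContMDiffAt 𝓘(ℝ, E) 𝓘(ℝ, ℝ) ∞ (fun y => ∑ j, r.1 (b.coord i) (b.coord j)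
          * (ldiff e f y (b i) * ldiff e k y (b j))) g :=
        contMDiffAt_finsetSum fun j _ => contMDiffAt_const.mul
          ((contMDiff_tmap_ltr hf _ g).mul (contMDiff_tmap_ltr hk _ g))
      exact this.mdifferentiableAt (by simp)
    rw [h1, ldiff_apply, tmap_sum _ fun i _ => hs i, sum_apply]
    refine Finset.sum_congr rfl fun i _ => ?_
    rw [tmap_sum _ fun j _ => hcm i j, sum_apply]
    refine Finset.sum_congr rfl fun j _ => ?_
    rw [tmap_const_mul (hm i j), tmap_mul (hX hf _) (hX hk _)]
    simp only [smul_apply, add_apply, smul_eq_mul,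
      ← ldiff_apply]
    ring
  -- The covector `w ↦ X_a X_w f` at `g`. It reassembles the coordinate sum into `r(df, Q k) + r(Q
  -- f, dk)`; skewness of `r` gives the sign of the second term.
  let Q : (G → ℝ) → Module.Dual ℝ V := fun f =>
    ∑ i, ldiff e (fun y => ldiff e f y (b i)) g a • b.coord i
  have hQ : ∀ {f : G → ℝ}, ContMDiff 𝓘(ℝ, E) 𝓘(ℝ, ℝ) ∞ f → ∀ w : V,
      ldiff e (fun y => ldiff e f y w) g a = Q f w := fun hf w => by
    rw [hlin hf]
    simp only [Q, LinearMap.sum_apply, LinearMap.smul_apply, smul_eq_mul, mul_comm]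
  rw [h2, hQ hk, hQ hf, Bivector.dual_sharp, Bivector.dual_sharp, Bivector.apply_swap r _ (Q f),
    Bivector.apply_eq_sum b r, Bivector.apply_eq_sum b r (Q f), sub_neg_eq_add, ← Finset.sum_add_distrib]
  refine Finset.sum_congr rfl fun i _ => ?_
  rw [← Finset.sum_add_distrib]
  refine Finset.sum_congr rfl fun j _ => ?_
  rw [hQ hk, hQ hf]
  ring

end Invariant

/-! ### Lifting functions from `G/H`; infinitesimal `H`-invariance. -/

namespace ReductiveDecomposition

variable {E : Type*} [NormedAddCommGroup E] [NormedSpace ℝ E]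
  {G : Type*} [TopologicalSpace G] [ChartedSpace E G] [Group G]
  {H : Subgroup G} (D : ReductiveDecomposition E H)
  {F : Type*} [NormedAddCommGroup F] [NormedSpace ℝ F] [ChartedSpace F (G ⧸ H)]

/-- The inclusion of `𝔪` into the model space. -/
def emb : D.𝔪 →ₗ[ℝ] E := D.𝔪.subtype

/-- The restriction of the tangent map of the projection to `𝔪`. -/
def tprojM : D.𝔪 →ₗ[ℝ] F := (tproj H : E →L[ℝ] F).toLinearMap ∘ₗ D.emb

variable [LieGroup 𝓘(ℝ, E) ∞ G]

theorem ldiff_comp_mk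
    (hp : Manifold.IsSubmersion 𝓘(ℝ, E) 𝓘(ℝ, F) ∞ (fun g : G => (g : G ⧸ H)))
    {f : G ⧸ H → ℝ} {g : G} (hf : MDifferentiableAt 𝓘(ℝ, F) 𝓘(ℝ, ℝ) f (g : G ⧸ H)) :
    ldiff D.emb (fun x : G => f x) g
      = (tmap f (g : G ⧸ H) : F →L[ℝ] ℝ).toLinearMap ∘ₗ
        ((tsmul g ((1 : G) : G ⧸ H) : F →L[ℝ] F).toLinearMap ∘ₗ D.tprojM) := by
  ext w
  have h1 : (tmap (fun x : G => f x) g : E →L[ℝ] ℝ)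
      = (tmap f (g : G ⧸ H) : F →L[ℝ] ℝ).comp (tmap (fun x : G => (x : G ⧸ H)) g) :=
    tmap_comp (f := f) g hf (hp.contMDiff.mdifferentiableAt (by simp))
  have h2 := congrArg (fun l : E →L[ℝ] F => l (D.emb w)) (tmap_mk_ltr hp g)
  rw [ldiff_apply, h1]
  exact congrArg (tmap f (g : G ⧸ H) : F →L[ℝ] ℝ) h2

theorem tangentProj_proj [FiniteDimensional ℝ E] [T2Space G] [T2Space (G ⧸ H)]
    [IsManifold 𝓘(ℝ, F) ∞ (G ⧸ H)]
    (hp : Manifold.IsSubmersion 𝓘(ℝ, E) 𝓘(ℝ, F) ∞ (fun g : G => (g : G ⧸ H)))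
    (w : GroupLieAlgebra 𝓘(ℝ, E) G) :
    tangentProj (F := F) H (D.proj w : GroupLieAlgebra 𝓘(ℝ, E) G) = tangentProj (F := F) H w := by
  rw [eq_comm, ← sub_eq_zero, ← map_sub]
  exact (tangentProj_eq_zero_iff hp _).2 (D.sub_proj_mem w)

/-- Lifted functions are constant to first order along `𝔥`. This is what turns the bracket of `𝔤`
into `[·,·]_𝔪`. -/
theorem tmap_ltr_eq_ldiff_proj [FiniteDimensional ℝ E] [T2Space G] [T2Space (G ⧸ H)]
    [IsManifold 𝓘(ℝ, F) ∞ (G ⧸ H)]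
    (hp : Manifold.IsSubmersion 𝓘(ℝ, E) 𝓘(ℝ, F) ∞ (fun g : G => (g : G ⧸ H)))
    {f : G ⧸ H → ℝ} {g : G} (hf : MDifferentiableAt 𝓘(ℝ, F) 𝓘(ℝ, ℝ) f (g : G ⧸ H))
    (w : GroupLieAlgebra 𝓘(ℝ, E) G) :
    (tmap (fun x : G => f x) g : E →L[ℝ] ℝ) (ltr g w)
      = ldiff D.emb (fun x : G => f x) g (D.proj w) := by
  have h1 : (tmap (fun x : G => f x) g : E →L[ℝ] ℝ)
      = (tmap f (g : G ⧸ H) : F →L[ℝ] ℝ).comp (tmap (fun x : G => (x : G ⧸ H)) g) :=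
    tmap_comp (f := f) g hf (hp.contMDiff.mdifferentiableAt (by simp))
  have h2 := congrArg (fun l : E →L[ℝ] F => l w) (tmap_mk_ltr hp g)
  rw [D.ldiff_comp_mk hp hf, h1]
  refine congrArg (tmap f (g : G ⧸ H) : F →L[ℝ] ℝ) (h2.trans ?_)
  exact congrArg (tsmul g ((1 : G) : G ⧸ H) : F →L[ℝ] F) (D.tangentProj_proj hp w).symm

theorem tprojM_bijective [FiniteDimensional ℝ E] [T2Space G] [T2Space (G ⧸ H)]
    [IsManifold 𝓘(ℝ, F) ∞ (G ⧸ H)]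
    (hp : Manifold.IsSubmersion 𝓘(ℝ, E) 𝓘(ℝ, F) ∞ (fun g : G => (g : G ⧸ H))) :
    Function.Bijective (D.tprojM (F := F)) := by
  constructor
  · rw [injective_iff_map_eq_zero]
    intro w hw
    have h1 : (w : GroupLieAlgebra 𝓘(ℝ, E) G) ∈ subgroupLieAlgebra H :=
      (tangentProj_eq_zero_iff hp _).1 hw
    rw [← D.proj_eq_zero_iff, D.proj_coe] at h1
    exact h1
  · intro y
    obtain ⟨w, hw⟩ := hp.tmap_surjective 1 y
    refine ⟨D.proj w, ?_⟩
    exact (D.tangentProj_proj hp w).trans hw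

theorem tprojM_adM (hp : Manifold.IsSubmersion 𝓘(ℝ, E) 𝓘(ℝ, F) ∞ (fun g : G => (g : G ⧸ H)))
    (a : H) :
    (D.tprojM : D.𝔪 →ₗ[ℝ] F) ∘ₗ D.adM a
      = (tsmul (a : G) ((1 : G) : G ⧸ H) : F →L[ℝ] F).toLinearMap ∘ₗ D.tprojM := by
  ext w
  exact tproj_conjDeriv hp a.2 (D.emb w)

theorem lieAd_mem_subgroupLieAlgebra [FiniteDimensional ℝ E] [T2Space G] [T2Space (G ⧸ H)]
    [IsManifold 𝓘(ℝ, F) ∞ (G ⧸ H)]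
    (hp : Manifold.IsSubmersion 𝓘(ℝ, E) 𝓘(ℝ, F) ∞ (fun g : G => (g : G ⧸ H))) (a : H)
    {w : GroupLieAlgebra 𝓘(ℝ, E) G} (hw : w ∈ subgroupLieAlgebra H) :
    lieAd (a : G) w ∈ subgroupLieAlgebra H := by
  rw [← tangentProj_eq_zero_iff hp] at hw ⊢
  refine (tproj_conjDeriv hp a.2 w).trans ?_
  exact (congrArg (tsmul (a : G) ((1 : G) : G ⧸ H) : F →L[ℝ] F) hw).trans (map_zero _)

/-- The Lie derivative along `𝔥` of invariant covectors vanishes. -/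
theorem apply_proj_lie_eq_zero [FiniteDimensional ℝ E] [T2Space G]
    {α : Module.Dual ℝ D.𝔪} {v : D.𝔪} (h : ∀ a : H, α (D.adM a v) = α v)
    {x : GroupLieAlgebra 𝓘(ℝ, E) G} (hx : x ∈ subgroupLieAlgebra H) :
    letI := FiniteDimensional.complete ℝ E
    α (D.proj ⁅x, (v : GroupLieAlgebra 𝓘(ℝ, E) G)⁆) = 0 := by
  have := FiniteDimensional.complete ℝ E
  induction hx using Submodule.span_induction with
  | zero => rw [zero_lie, map_zero, map_zero]
  | add x y _ _ hx hy => rw [add_lie, map_add, map_add, hx, hy, add_zero]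
  | smul c x _ hx => rw [smul_lie, map_smul, map_smul, hx, smul_zero]
  | mem x hx =>
    obtain ⟨γ, h0, hγ, hmem⟩ := hx
    have hγ' : IsMIntegralCurve (I := 𝓘(ℝ, E)) γ (linvField G x) := hγ
    let l : E →ₗ[ℝ] ℝ := α ∘ₗ D.proj
    have h1 := apply_modelBracket_eq_zero h0 (hγ'.tmap_one 0).1 (LinearMap.toContinuousLinearMap l)
      (D.emb v) fun t => by
        have e1 : D.proj (lieAd (γ t) (v : GroupLieAlgebra 𝓘(ℝ, E) G)) = D.adM ⟨γ t, hmem t⟩ v :=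
          D.proj_coe (D.adM ⟨γ t, hmem t⟩ v)
        have e2 : α (D.proj (lieAd (γ t) (v : GroupLieAlgebra 𝓘(ℝ, E) G))) = α (D.proj v) := by
          rw [e1, h, D.proj_coe]
        exact e2
    rw [hγ'.tmap_ltr, h0, ltr_one] at h1
    exact h1

/-- Differentiate `Ad_{γ(t)} u = u` along the curves in `H` whose initial velocities span `𝔥`,
testing against all linear forms. -/
theorem lie_invariant_eq_zero [FiniteDimensional ℝ E] [T2Space G]
    {u : D.𝔪} (hu : u ∈ D.invariants)
    {x : GroupLieAlgebra 𝓘(ℝ, E) G} (hx : x ∈ subgroupLieAlgebra H) :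
    letI := FiniteDimensional.complete ℝ E
    ⁅x, (u : GroupLieAlgebra 𝓘(ℝ, E) G)⁆ = 0 := by
  have := FiniteDimensional.complete ℝ E
  induction hx using Submodule.span_induction with
  | zero => rw [zero_lie]
  | add x y _ _ hx hy => rw [add_lie, hx, hy, add_zero]
  | smul c x _ hx => rw [smul_lie, hx, smul_zero]
  | mem x hx =>
    obtain ⟨γ, h0, hγ, hmem⟩ := hx
    have hγ' : IsMIntegralCurve (I := 𝓘(ℝ, E)) γ (linvField G x) := hγ
    have h2 : ∀ l : E →L[ℝ] ℝ, l (modelBracket G x (D.emb u) : E) = 0 := fun l => by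
      have h1 := apply_modelBracket_eq_zero h0 (hγ'.tmap_one 0).1 l (D.emb u) fun t => by
        have e1 : lieAd (γ t) (u : GroupLieAlgebra 𝓘(ℝ, E) G) = u :=
          congrArg Subtype.val (hu ⟨γ t, hmem t⟩)
        exact congrArg l e1
      rw [hγ'.tmap_ltr, h0, ltr_one] at h1
      exact h1
    have h3 : (modelBracket G x (D.emb u) : E) = (0 : E) :=
      SeparatingDual.eq_zero_of_forall_dual_eq_zero (R := ℝ) (V := E) h2
    exact h3

end ReductiveDecomposition

/-! ### Invariant bivector fields on `G/H` and their Jacobiator. -/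

namespace ReductiveDecomposition

variable {E : Type*} [NormedAddCommGroup E] [NormedSpace ℝ E]
  {G : Type*} [TopologicalSpace G] [ChartedSpace E G] [Group G]
  {H : Subgroup G} (D : ReductiveDecomposition E H)
  {F : Type*} [NormedAddCommGroup F] [NormedSpace ℝ F] [ChartedSpace F (G ⧸ H)]

/-- The push-forward of `r` to the tangent space of `G ⧸ H` at the class of `g`. -/
def pushforward (r : Bivector D.𝔪) (g : G) : Bivector F :=
  Bivector.map ((tsmul g ((1 : G) : G ⧸ H) : F →L[ℝ] F).toLinearMap ∘ₗ D.tprojM) r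

theorem pushforward_one (r : Bivector D.𝔪) :
    D.pushforward (F := F) r 1 = Bivector.map D.tprojM r := by
  rw [pushforward, tsmul_one]
  rfl

variable [LieGroup 𝓘(ℝ, E) ∞ G]

theorem pushforward_mul
    (hp : Manifold.IsSubmersion 𝓘(ℝ, E) 𝓘(ℝ, F) ∞ (fun g : G => (g : G ⧸ H)))
    (r : Bivector D.𝔪) (g g' : G) :
    D.pushforward (F := F) r (g * g')
      = Bivector.map (tsmul g (g' : G ⧸ H) : F →L[ℝ] F).toLinearMap (D.pushforward r g') := by
  have h : g' • ((1 : G) : G ⧸ H) = (g' : G ⧸ H) := by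
    rw [MulAction.Quotient.smul_coe, smul_eq_mul, mul_one]
  rw [pushforward, tsmul_mul hp, h]
  rfl

/-- Moving `g` within its coset changes `r` by some `Ad_a`, which `r` absorbs; the push-forward
therefore depends only on the point of `G/H`. -/
theorem pushforward_mul_mem
    (hp : Manifold.IsSubmersion 𝓘(ℝ, E) 𝓘(ℝ, F) ∞ (fun g : G => (g : G ⧸ H)))
    {r : Bivector D.𝔪} (hr : r ∈ D.bivectorInvariants) (g : G) (a : H) :
    D.pushforward (F := F) r (g * a) = D.pushforward r g := by
  have h1 : ((a : G) : G ⧸ H) = ((1 : G) : G ⧸ H) := QuotientGroup.eq.2 (by simp)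
  have h2 : D.pushforward (F := F) r a = Bivector.map D.tprojM r := by
    rw [pushforward, ← D.tprojM_adM hp, Bivector.map_comp, hr a]
  rw [D.pushforward_mul hp, h1, h2]
  rfl

theorem pushforward_out
    (hp : Manifold.IsSubmersion 𝓘(ℝ, E) 𝓘(ℝ, F) ∞ (fun g : G => (g : G ⧸ H)))
    {r : Bivector D.𝔪} (hr : r ∈ D.bivectorInvariants) (g : G) :
    D.pushforward (F := F) r (g : G ⧸ H).out = D.pushforward r g := by
  obtain ⟨a, ha⟩ := QuotientGroup.mk_out_eq_mul H g
  rw [ha, D.pushforward_mul_mem hp hr]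

theorem pushforward_apply
    (hp : Manifold.IsSubmersion 𝓘(ℝ, E) 𝓘(ℝ, F) ∞ (fun g : G => (g : G ⧸ H)))
    (r : Bivector D.𝔪) {g : G} {f k : G ⧸ H → ℝ}
    (hf : MDifferentiableAt 𝓘(ℝ, F) 𝓘(ℝ, ℝ) f (g : G ⧸ H))
    (hk : MDifferentiableAt 𝓘(ℝ, F) 𝓘(ℝ, ℝ) k (g : G ⧸ H)) :
    (D.pushforward r g).1 (tmap f (g : G ⧸ H) : F →L[ℝ] ℝ).toLinearMap
        (tmap k (g : G ⧸ H) : F →L[ℝ] ℝ).toLinearMap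
      = r.1 (ldiff D.emb (fun x : G => f x) g) (ldiff D.emb (fun x : G => k x) g) := by
  rw [D.ldiff_comp_mk hp hf, D.ldiff_comp_mk hp hk]
  rfl

theorem isInvariant_iff
    (hp : Manifold.IsSubmersion 𝓘(ℝ, E) 𝓘(ℝ, F) ∞ (fun g : G => (g : G ⧸ H)))
    [IsManifold 𝓘(ℝ, F) ∞ (G ⧸ H)] {r : Bivector D.𝔪} {π : BivectorField F (G ⧸ H)}
    (h1 : π.toFun ((1 : G) : G ⧸ H) = Bivector.map (tangentProj H ∘ₗ D.𝔪.subtype) r) :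
    π.IsInvariant G ↔ ∀ g : G, π.toFun (g : G ⧸ H) = D.pushforward (F := F) r g := by
  constructor
  · intro h g
    have h2 := h g ((1 : G) : G ⧸ H)
    have h3 : g • ((1 : G) : G ⧸ H) = (g : G ⧸ H) := by
      rw [MulAction.Quotient.smul_coe, smul_eq_mul, mul_one]
    rw [h1] at h2
    -- The type of `π.toFun` depends on the point, so the equality of points is eliminated with both
    -- endpoints generalised.
    have h4 : ∀ {y z : G ⧸ H} (_ : y = z) (b : Bivector F), b = π.toFun y → π.toFun z = b := by
      rintro y _ rfl b hb
      exact hb.symm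
    exact h4 h3 _ h2
  · intro h g x
    obtain ⟨g', rfl⟩ := QuotientGroup.mk_surjective x
    rw [h g']
    exact (D.pushforward_mul hp r g g').symm.trans (h (g * g')).symm

theorem bracketField_apply
    (hp : Manifold.IsSubmersion 𝓘(ℝ, E) 𝓘(ℝ, F) ∞ (fun g : G => (g : G ⧸ H)))
    {r : Bivector D.𝔪} {π : BivectorField F (G ⧸ H)}
    (hπ : ∀ g : G, π.toFun (g : G ⧸ H) = D.pushforward (F := F) r g) {f k : G ⧸ H → ℝ}
    (hf : ContMDiff 𝓘(ℝ, F) 𝓘(ℝ, ℝ) ∞ f) (hk : ContMDiff 𝓘(ℝ, F) 𝓘(ℝ, ℝ) ∞ k) (g : G) :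
    π.bracket f k (g : G ⧸ H)
      = r.1 (ldiff D.emb (fun x : G => f x) g) (ldiff D.emb (fun x : G => k x) g) := by
  rw [← D.pushforward_apply hp r (hf.mdifferentiableAt (by simp)) (hk.mdifferentiableAt (by simp)),
    ← hπ]
  rfl

variable [FiniteDimensional ℝ E]

/-- The invariant bivector field on `G ⧸ H` with the value `r` at the base point. -/
def invariantField (hp : Manifold.IsSubmersion 𝓘(ℝ, E) 𝓘(ℝ, F) ∞ (fun g : G => (g : G ⧸ H)))
    [IsManifold 𝓘(ℝ, F) ∞ (G ⧸ H)]
    (r : Bivector D.𝔪) (hr : r ∈ D.bivectorInvariants) : BivectorField F (G ⧸ H) where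
  toFun x := D.pushforward (F := F) r x.out
  smooth := by
    intro U hU f k hf hk x hx
    obtain ⟨g, rfl⟩ := QuotientGroup.mk_surjective x
    refine ContMDiffAt.contMDiffWithinAt (hp.contMDiffAt_of_comp ?_)
    have hmk : ContMDiff 𝓘(ℝ, E) 𝓘(ℝ, F) ∞ (fun g : G => (g : G ⧸ H)) := hp.contMDiff
    have hf' : ∀ y ∈ U, ContMDiffAt 𝓘(ℝ, F) 𝓘(ℝ, ℝ) ∞ f y :=
      fun y hy => hf.contMDiffAt (hU.mem_nhds hy)
    have hk' : ∀ y ∈ U, ContMDiffAt 𝓘(ℝ, F) 𝓘(ℝ, ℝ) ∞ k y :=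
      fun y hy => hk.contMDiffAt (hU.mem_nhds hy)
    have h1 := contMDiffAt_apply_ldiff D.emb r (f := fun x : G => f x) (k := fun x : G => k x)
      ((hf' _ hx).comp g hmk.contMDiffAt) ((hk' _ hx).comp g hmk.contMDiffAt)
    refine h1.congr_of_eventuallyEq ?_
    filter_upwards [(hU.preimage hmk.continuous).mem_nhds hx] with y hy
    rw [← D.pushforward_apply hp r ((hf' _ hy).mdifferentiableAt (by simp))
      ((hk' _ hy).mdifferentiableAt (by simp)), ← D.pushforward_out hp hr]
    rfl

section Jacobi

/-- The Leibniz rule applied to the lift of `{k, l}`. The vectors fed to the inner derivatives are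
frozen at `g`, so these are iterated derivatives along left-invariant fields. -/
theorem bracketField_bracketField_apply
    (hp : Manifold.IsSubmersion 𝓘(ℝ, E) 𝓘(ℝ, F) ∞ (fun g : G => (g : G ⧸ H)))
    {r : Bivector D.𝔪} {π : BivectorField F (G ⧸ H)}
    (hπ : ∀ g : G, π.toFun (g : G ⧸ H) = D.pushforward (F := F) r g) {f k l : G ⧸ H → ℝ}
    (hf : ContMDiff 𝓘(ℝ, F) 𝓘(ℝ, ℝ) ∞ f) (hk : ContMDiff 𝓘(ℝ, F) 𝓘(ℝ, ℝ) ∞ k)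
    (hl : ContMDiff 𝓘(ℝ, F) 𝓘(ℝ, ℝ) ∞ l) (g : G) :
    π.bracket f (π.bracket k l) (g : G ⧸ H)
      = ldiff D.emb (fun y => ldiff D.emb (fun x : G => l x) y
          (Bivector.sharp r (ldiff D.emb (fun x : G => k x) g))) g
          (Bivector.sharp r (ldiff D.emb (fun x : G => f x) g))
        - ldiff D.emb (fun y => ldiff D.emb (fun x : G => k x) y
          (Bivector.sharp r (ldiff D.emb (fun x : G => l x) g))) g
          (Bivector.sharp r (ldiff D.emb (fun x : G => f x) g)) := by
  have hkl : ContMDiff 𝓘(ℝ, F) 𝓘(ℝ, ℝ) ∞ (π.bracket k l) :=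
    contMDiffOn_univ.1 (π.smooth univ isOpen_univ k l hk.contMDiffOn hl.contMDiffOn)
  have h1 : (fun x : G => π.bracket k l (x : G ⧸ H)) = _ :=
    funext fun x => D.bracketField_apply hp hπ hk hl x
  rw [D.bracketField_apply hp hπ hf hkl, h1, ← Bivector.dual_sharp]
  exact ldiff_apply_ldiff D.emb r (hk.comp hp.contMDiff) (hl.comp hp.contMDiff) g _

variable [T2Space G] [T2Space (G ⧸ H)] [IsManifold 𝓘(ℝ, F) ∞ (G ⧸ H)]

/-- Each of `f`, `k`, `l` is differentiated twice in two opposite orders, so only commutators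
survive. -/
theorem jacobiator_apply
    (hp : Manifold.IsSubmersion 𝓘(ℝ, E) 𝓘(ℝ, F) ∞ (fun g : G => (g : G ⧸ H)))
    {r : Bivector D.𝔪} {π : BivectorField F (G ⧸ H)}
    (hπ : ∀ g : G, π.toFun (g : G ⧸ H) = D.pushforward (F := F) r g) {f k l : G ⧸ H → ℝ}
    (hf : ContMDiff 𝓘(ℝ, F) 𝓘(ℝ, ℝ) ∞ f) (hk : ContMDiff 𝓘(ℝ, F) 𝓘(ℝ, ℝ) ∞ k)
    (hl : ContMDiff 𝓘(ℝ, F) 𝓘(ℝ, ℝ) ∞ l) (g : G) {α β γ : Module.Dual ℝ D.𝔪}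
    (hα : ldiff D.emb (fun x : G => f x) g = α) (hβ : ldiff D.emb (fun x : G => k x) g = β)
    (hγ : ldiff D.emb (fun x : G => l x) g = γ) :
    (π.bracket f (π.bracket k l) + π.bracket k (π.bracket l f) + π.bracket l (π.bracket f k))
        (g : G ⧸ H)
      = γ (D.bracketM (Bivector.sharp r α) (Bivector.sharp r β))
        + β (D.bracketM (Bivector.sharp r γ) (Bivector.sharp r α))
        + α (D.bracketM (Bivector.sharp r β) (Bivector.sharp r γ)) := by
  have := FiniteDimensional.complete ℝ E
  have key : ∀ {f : G ⧸ H → ℝ}, ContMDiff 𝓘(ℝ, F) 𝓘(ℝ, ℝ) ∞ f → ∀ a b : D.𝔪,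
      ldiff D.emb (fun x : G => f x) g (D.bracketM a b)
        = ldiff D.emb (fun y => ldiff D.emb (fun x : G => f x) y b) g a
          - ldiff D.emb (fun y => ldiff D.emb (fun x : G => f x) y a) g b := fun {f} hf a b => by
    have h1 := D.tmap_ltr_eq_ldiff_proj hp (g := g) (hf.mdifferentiableAt (by simp))
      (modelBracket (E := E) G (D.emb a) (D.emb b))
    exact h1.symm.trans (tmap_ltr_modelBracket (hf.comp hp.contMDiff) (D.emb a) (D.emb b) g)
  simp only [Pi.add_apply]
  rw [D.bracketField_bracketField_apply hp hπ hf hk hl,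
    D.bracketField_bracketField_apply hp hπ hk hl hf,
    D.bracketField_bracketField_apply hp hπ hl hf hk, hα, hβ, hγ]
  have e1 := key hl (Bivector.sharp r α) (Bivector.sharp r β)
  have e2 := key hk (Bivector.sharp r γ) (Bivector.sharp r α)
  have e3 := key hf (Bivector.sharp r β) (Bivector.sharp r γ)
  rw [hγ] at e1
  rw [hβ] at e2
  rw [hα] at e3
  rw [e1, e2, e3]
  ring

/-- The Jacobiator is the same algebraic expression at every `g`. At `1` its three covectors can be
chosen freely. -/
theorem isPoisson_iff
    (hp : Manifold.IsSubmersion 𝓘(ℝ, E) 𝓘(ℝ, F) ∞ (fun g : G => (g : G ⧸ H)))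
    {r : Bivector D.𝔪} {π : BivectorField F (G ⧸ H)}
    (hπ : ∀ g : G, π.toFun (g : G ⧸ H) = D.pushforward (F := F) r g) :
    π.IsPoisson ↔ D.IsYangBaxter r := by
  rw [D.isYangBaxter_iff]
  constructor
  · intro h
    let T : D.𝔪 ≃ₗ[ℝ] F := LinearEquiv.ofBijective D.tprojM (D.tprojM_bijective hp)
    have : FiniteDimensional ℝ F := T.finiteDimensional
    have hex : ∀ α : Module.Dual ℝ D.𝔪, ∃ f : G ⧸ H → ℝ, ContMDiff 𝓘(ℝ, F) 𝓘(ℝ, ℝ) ∞ f ∧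
        ldiff D.emb (fun x : G => f x) 1 = α := fun α => by
      obtain ⟨f, hf, hfl⟩ := exists_contMDiff_tmap_eq ((1 : G) : G ⧸ H)
        (LinearMap.toContinuousLinearMap (α ∘ₗ T.symm.toLinearMap))
      refine ⟨f, hf, ?_⟩
      rw [D.ldiff_comp_mk hp (hf.mdifferentiableAt (by simp)), hfl, tsmul_one]
      ext w
      exact congrArg α (T.symm_apply_apply w)
    intro α β γ
    obtain ⟨f, hf, hfα⟩ := hex α
    obtain ⟨k, hk, hkβ⟩ := hex β
    obtain ⟨l, hl, hlγ⟩ := hex γ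
    rw [← D.jacobiator_apply hp hπ hf hk hl 1 hfα hkβ hlγ, h f k l hf hk hl]
    rfl
  · intro h f k l hf hk hl
    ext x
    obtain ⟨g, rfl⟩ := QuotientGroup.mk_surjective x
    rw [D.jacobiator_apply hp hπ hf hk hl g rfl rfl rfl]
    exact h _ _ _

end Jacobi

end ReductiveDecomposition

theorem BivectorField.ext_toFun {F : Type*} [NormedAddCommGroup F] [NormedSpace ℝ F]
    {M : Type*} [TopologicalSpace M] [ChartedSpace F M] {π π' : BivectorField F M}
    (h : ∀ x, π.toFun x = π'.toFun x) : π = π' := by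
  obtain ⟨a, _⟩ := π
  obtain ⟨b, _⟩ := π'
  obtain rfl : a = b := funext h
  rfl

end

/-! ### Assembly of the bijection and the Lie algebra statements. -/

theorem mainTheorem3
    {E : Type*} [NormedAddCommGroup E] [NormedSpace ℝ E] [FiniteDimensional ℝ E]
    {G : Type*} [TopologicalSpace G] [ChartedSpace E G] [Group G] [LieGroup 𝓘(ℝ, E) ∞ G]
    [ConnectedSpace G]
    (H : Subgroup G) (hH : IsClosed (H : Set G))
    {F : Type*} [NormedAddCommGroup F] [NormedSpace ℝ F]
    [ChartedSpace F (G ⧸ H)] [IsManifold 𝓘(ℝ, F) ∞ (G ⧸ H)]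
    (hp : Manifold.IsSubmersion 𝓘(ℝ, E) 𝓘(ℝ, F) ∞ (fun g : G => (g : G ⧸ H)))
    (D : ReductiveDecomposition E H) :
    (∃ Θ : {π : BivectorField F (G ⧸ H) // π.IsInvariant G ∧ π.IsPoisson} ≃
        {r : Bivector D.𝔪 // r ∈ D.bivectorInvariants ∧ D.IsYangBaxter r},
      ∀ π, π.1.toFun ((1 : G) : G ⧸ H) =
        Bivector.map (tangentProj H ∘ₗ D.𝔪.subtype) (Θ π).1) ∧
    IsLieBracketOn D.bracketM D.invariants ∧
    ∀ r : Bivector D.𝔪, r ∈ D.bivectorInvariants → D.IsYangBaxter r →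
      IsLieBracketOn (D.dualBracket r) D.dualInvariants ∧
      IsLieMorphismOn (Bivector.sharp r) (D.dualBracket r) D.dualInvariants
        D.bracketM D.invariants := by
  have : CompleteSpace E := FiniteDimensional.complete ℝ E
  have : IsTopologicalGroup G := topologicalGroup_of_lieGroup 𝓘(ℝ, E) ∞
  -- Charts make points closed, hence the topological group `G` is Hausdorff; closedness of `H` does
  -- the same for `G/H`.
  have : T1Space G := ChartedSpace.t1Space E G
  have : T2Space G := inferInstance
  have : T2Space (G ⧸ H) := inferInstance
  have hAd : ∀ (a : H) (w : GroupLieAlgebra 𝓘(ℝ, E) G),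
      D.proj (lieAd (a : G) w) = D.adM a (D.proj w) :=
    fun a w => D.proj_lieAd (fun w hw => ReductiveDecomposition.lieAd_mem_subgroupLieAlgebra hp a hw) w
  have hlie : ∀ (a : G) (u v : GroupLieAlgebra 𝓘(ℝ, E) G), lieAd a ⁅u, v⁆ = ⁅lieAd a u, lieAd a v⁆ :=
    fun a u v => conjDeriv_modelBracket (E := E) a u v
  have hinv : ∀ x ∈ subgroupLieAlgebra (E := E) H, ∀ u ∈ D.invariants,
      ⁅x, (u : GroupLieAlgebra 𝓘(ℝ, E) G)⁆ = 0 := fun x hx u hu => D.lie_invariant_eq_zero hu hx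
  have hdual : ∀ x ∈ subgroupLieAlgebra (E := E) H, ∀ α ∈ D.dualInvariants, ∀ v : D.𝔪,
      α (D.proj ⁅x, (v : GroupLieAlgebra 𝓘(ℝ, E) G)⁆) = 0 := fun x hx α hα v =>
    D.apply_proj_lie_eq_zero (fun a => congrArg (fun l : Module.Dual ℝ D.𝔪 => l v) (hα a)) hx
  refine ⟨?_, D.isLieBracketOn_bracketM hAd hlie hinv, fun r hr hYB =>
    ⟨D.isLieBracketOn_dualBracket hAd hlie hinv hdual hr hYB,
      fun α hα => D.sharp_mem_invariants hr hα, fun α _ β _ => hYB α β⟩⟩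
  let T : D.𝔪 ≃ₗ[ℝ] F := LinearEquiv.ofBijective D.tprojM (D.tprojM_bijective hp)
  let ρ : BivectorField F (G ⧸ H) → Bivector D.𝔪 := fun π =>
    Bivector.map T.symm.toLinearMap (π.toFun ((1 : G) : G ⧸ H))
  have hT1 : D.tprojM ∘ₗ T.symm.toLinearMap = (LinearMap.id : F →ₗ[ℝ] F) := by
    ext y
    exact T.apply_symm_apply y
  have hT2 : T.symm.toLinearMap ∘ₗ D.tprojM = LinearMap.id := by
    ext y
    exact congrArg Subtype.val (T.symm_apply_apply y)
  have hρ : ∀ π : BivectorField F (G ⧸ H), π.toFun ((1 : G) : G ⧸ H) =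
      Bivector.map (tangentProj H ∘ₗ D.𝔪.subtype) (ρ π) := fun π => by
    have h (b : Bivector F) : Bivector.map (D.tprojM ∘ₗ T.symm.toLinearMap) b = b := by
      rw [hT1]
      rfl
    exact (h (π.toFun ((1 : G) : G ⧸ H))).symm
  have hinvr : ∀ π : BivectorField F (G ⧸ H), π.IsInvariant G → ρ π ∈ D.bivectorInvariants := by
    intro π hπ a
    have h1 := (D.isInvariant_iff hp (hρ π)).1 hπ
    refine Bivector.map_injective hT2 ?_
    -- Both `a` and `1` represent the base point, so the push-forwards of `ρ π` by them agree.
    -- Cancelling the injective `T_e p` on `𝔪` leaves `Ad_a`-invariance.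
    have h2 : ((a : G) : G ⧸ H) = ((1 : G) : G ⧸ H) := QuotientGroup.eq.2 (by simp)
    rw [← Bivector.map_comp, D.tprojM_adM hp]
    have h3 : D.pushforward (F := F) (ρ π) a = D.pushforward (F := F) (ρ π) 1 := by
      have h4 : ∀ {y z : G ⧸ H} (_ : y = z), (π.toFun y : Bivector F) = π.toFun z := by
        rintro y _ rfl
        rfl
      exact (h1 a).symm.trans ((h4 h2).trans (h1 1))
    rw [D.pushforward_one] at h3
    exact h3
  have hmem : ∀ π : {π : BivectorField F (G ⧸ H) // π.IsInvariant G ∧ π.IsPoisson},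
      ρ π.1 ∈ D.bivectorInvariants ∧ D.IsYangBaxter (ρ π.1) := fun π =>
    ⟨hinvr _ π.2.1, (D.isPoisson_iff hp ((D.isInvariant_iff hp (hρ π.1)).1 π.2.1)).1 π.2.2⟩
  refine ⟨Equiv.ofBijective (fun π => ⟨ρ π.1, hmem π⟩) ⟨?_, ?_⟩, fun π => hρ π.1⟩
  · intro π π' h
    have hr : ρ π.1 = ρ π'.1 := congrArg Subtype.val h
    refine Subtype.ext (BivectorField.ext_toFun fun x => ?_)
    obtain ⟨g, rfl⟩ := QuotientGroup.mk_surjective x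
    rw [(D.isInvariant_iff hp (hρ π.1)).1 π.2.1 g, hr,
      (D.isInvariant_iff hp (hρ π'.1)).1 π'.2.1 g]
  · rintro ⟨r, hr, hYB⟩
    have h1 : ∀ g : G, (D.invariantField hp r hr).toFun (g : G ⧸ H) = D.pushforward (F := F) r g :=
      fun g => D.pushforward_out hp hr g
    have h2 : (D.invariantField hp r hr).toFun ((1 : G) : G ⧸ H)
        = Bivector.map (tangentProj H ∘ₗ D.𝔪.subtype) r := (h1 1).trans (D.pushforward_one r)
    refine ⟨⟨D.invariantField hp r hr, (D.isInvariant_iff hp h2).2 h1,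
      (D.isPoisson_iff hp h1).2 hYB⟩, Subtype.ext ?_⟩
    refine Bivector.map_injective hT2 ?_
    exact (hρ (D.invariantField hp r hr)).symm.trans h2
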